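/- **Setting.** A knapsack has size $k$, and $n$ items arrive at times $1,\dots,n$, where $80\le k\le n/2$. Let $\ell$ be $\frac{n\ln k}{k}$ rounded (up or down) to an integer. Split $\{1,\dots,n\}$ into consecutive windows $\{1,\dots,\ell\},\{\ell+1,\dots,2\ell\},\dots$. Let $\Gamma\ge\sqrt k$ be an integer with $\frac{\Gamma\ell}{n}\le\frac12$. The times are partitioned into random-order times $RO$ and adversarial times, and a fixed collection of at most $\Gamma$ windows (the adversarial windows) covers all adversarial times. A time is *free* if it lies in no adversarial window. There are $|RO|$ fixed random-order items with values $v_i>0$ and sizes $w_i\in(0,1]$, the densities $v_i/w_i$ are pairwise distinct, and $\sum_i w_i\ge k$. Let $\mathrm{OPT}_{RO}=\max\{\sum_i v_ix_i:\sum_i w_ix_i\le k,\ x\in[0,1]^{|RO|}\}$. A uniformly random bijection $I$ from $RO$ to the items determines the item $I_t$, with value $V_t=v_{I_t}$ and size $W_t=w_{I_t}$, that arrives at each $t\in RO$. At adversarial times an adversary outputs arbitrary values $V_t\ge 0$ and sizes $W_t\in[0,1]$, which may depend on all of $I$ and on the algorithm's behaviour. **Algorithm.** Let $a_1=601$, $c_t=1-\frac{4\Gamma\ell}{t}$,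 and let $a_4$ be a constant. At time $t$ the algorithm takes an arbitrary optimal solution $X^t$ of the linear program of maximizing $\sum_{s\le t}V_sX_s$ over $X\in[0,1]^t$ subject to $\sum_{s\le t}W_sX_s\le c_t\frac tn k$ and $\sum_{s\in B,\,s\le t}W_sX_s\le a_1\frac{\ell}{n}k$ for every window $B$ (its behaviour is unrestricted if this program is infeasible, i.e. if $c_t<0$). Let $T_t=1$ if $X^t_t>0$ and $T_t=0$ otherwise. Let $F_t=1$ (the algorithm is not blocked) if $$\sum_{s<t,\ s\text{ in the window of }t}W_sX^{alg}_s\le a_4\tfrac{\ell}{n}k-1\quad\text{and}\quad\sum_{s<t}W_sX^{alg}_s\le k-1,$$ and $F_t=0$ otherwise. The algorithm selects $X^{alg}_t=T_tF_t\in\{0,1\}$ of the item. **Theorem (Value lower bound).** For every sufficiently large constant $a_4$ there are constants $C,a_5>0$, depending only on $a_4$, such that the following holds for all instances, all adversaries and all choices of optimal LP solutions as above. Put $$p_t=\frac{C}{k\left(1-\frac tn-a_5\frac{\Gamma\ln k}{k}\right)^2}\ \text{ if } 1-\tfrac tn-a_5\tfrac{\Gamma\ln k}{k}>0,\qquad p_t=1\text{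 otherwise,}$$ $$\varepsilon_t=(a_1+3)\frac{\Gamma\ell}{t}+\sqrt{10\ln k}\,\sqrt{\frac{2n}{tk}}.$$ Then $p_t$ bounds the probability of being blocked, i.e. $\Pr(F_t=0\mid I_t=i)\le p_t$ for every free time $t\ge 8\ell(\Gamma+2)$ and every item $i$; and for every free time $t\ge 1212\,\Gamma\ell$ the expected value collected at time $t$ satisfies $$\mathbb E[V_tT_tF_t]\ \ge\ \left(c_t-\varepsilon_t-p_t-\frac2k\right)\frac{\mathrm{OPT}_{RO}}{|RO|}.$$ -/

import Mathlib

/-- The non-adaptive data of the knapsack problem with bursty adversary plus random order, together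
with the standing assumptions on them. Times are `1, …, n`; the windows are the consecutive blocks
`{1, …, ℓ}, {ℓ + 1, …, 2ℓ}, …`, the `j`-th one (from `j = 0`) being `{t : (t - 1) / ℓ = j}`. -/
structure BARO where
  /-- number of items -/
  n : ℕ
  /-- knapsack size -/
  k : ℝ
  /-- number of windows that may contain adversarial times -/
  Γ : ℕ
  /-- window length: `n ln k / k`, rounded up or down to an integer -/
  ℓ : ℕ
  /-- the random-order times; all other times in `{1, …, n}` are adversarial -/
  RO : Finset ℕ
  /-- indices of the adversarial windows -/
  Wadv : Finset ℕ
  /-- values of the random-order items -/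
  v : Fin RO.card → ℝ
  /-- sizes of the random-order items -/
  w : Fin RO.card → ℝ
  k_ge : 80 ≤ k
  k_le : k ≤ (n : ℝ) / 2
  ℓ_round : |(ℓ : ℝ) - n * Real.log k / k| < 1
  Γ_ge : Real.sqrt k ≤ Γ
  Γℓ_le : (Γ : ℝ) * ℓ / n ≤ 1 / 2
  RO_subset : RO ⊆ Finset.Icc 1 n
  card_Wadv : Wadv.card ≤ Γ
  adv_covered : ∀ t ∈ Finset.Icc 1 n, t ∉ RO → (t - 1) / ℓ ∈ Wadv
  v_pos : ∀ i, 0 < v i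
  w_pos : ∀ i, 0 < w i
  w_le_one : ∀ i, w i ≤ 1
  density_injective : Function.Injective fun i => v i / w i
  k_le_sum_w : k ≤ ∑ i, w i

namespace BARO

noncomputable section

variable (P : BARO)

/-- The index of the window containing time `t ≥ 1`. -/
def window (t : ℕ) : ℕ := (t - 1) / P.ℓ

/-- A free time: a time outside all adversarial windows. -/
def IsFree (t : ℕ) : Prop := t ∈ Finset.Icc 1 P.n ∧ P.window t ∉ P.Wadv

variable {P} in
theorem IsFree.mem_RO {t : ℕ} (h : P.IsFree t) : t ∈ P.RO := by
  by_contra h'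
  exact h.2 (P.adv_covered t h.1 h')

/-- The outcomes of sampling the random-order items without replacement: `I t` is the index of
the item that arrives at the random-order time `t`. All outcomes are equally likely. -/
abbrev Arrival : Type := P.RO ≃ Fin P.RO.card

/-- Expectation over the uniformly random arrival order. -/
def expect (f : P.Arrival → ℝ) : ℝ := (∑ I, f I) / Fintype.card P.Arrival

open Classical in
/-- The conditional probability of the event `E` given that item `i` arrives at time `t`. -/
def condProb (E : P.Arrival → Prop) (t : P.RO) (i : Fin P.RO.card) : ℝ :=
  ((Finset.univ.filter fun I : P.Arrival => I t = i ∧ E I).card : ℝ) /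
    (Finset.univ.filter fun I : P.Arrival => I t = i).card

/-- The items (value `V I t` and size `W I t`) output at each time `t` for each arrival order `I`:
prescribed at the random-order times, arbitrary at the adversarial times, where they may depend on
the whole of `I` (and thereby on everything the algorithm does). -/
structure Adversary where
  V : P.Arrival → ℕ → ℝ
  W : P.Arrival → ℕ → ℝ
  V_nonneg : ∀ I, ∀ t ∈ Finset.Icc 1 P.n, 0 ≤ V I t
  W_mem : ∀ I, ∀ t ∈ Finset.Icc 1 P.n, W I t ∈ Set.Icc (0 : ℝ) 1
  V_RO : ∀ I, ∀ t : P.RO, V I t = P.v (I t)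
  W_RO : ∀ I, ∀ t : P.RO, W I t = P.w (I t)

/-- The constant in the inner constraints. -/
def a₁ : ℝ := 601

/-- The budget scaling `c_t`. -/
def c (t : ℕ) : ℝ := 1 - 4 * P.Γ * P.ℓ / t

/-- Feasibility of `x` for the linear program `LP_t`, for sizes `W`. -/
def LPFeasible (W : ℕ → ℝ) (t : ℕ) (x : ℕ → ℝ) : Prop :=
  (∀ s ∈ Finset.Icc 1 t, x s ∈ Set.Icc (0 : ℝ) 1) ∧
  ∑ s ∈ Finset.Icc 1 t, W s * x s ≤ P.c t * (t / P.n) * P.k ∧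
  ∀ j : ℕ, ∑ s ∈ Finset.Icc 1 t with P.window s = j, W s * x s ≤ a₁ * (P.ℓ / P.n) * P.k

/-- Optimality of `x` for the linear program `LP_t`, for values `V` and sizes `W`. -/
def LPOptimal (V W : ℕ → ℝ) (t : ℕ) (x : ℕ → ℝ) : Prop :=
  P.LPFeasible W t x ∧ ∀ y, P.LPFeasible W t y →
    ∑ s ∈ Finset.Icc 1 t, V s * y s ≤ ∑ s ∈ Finset.Icc 1 t, V s * x s

/-- `X I t` is the optimal solution of `LP_t` that the algorithm uses. Ties between optimal
solutions are broken arbitrarily, and nothing is assumed about the early times at which `LP_t` is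
infeasible (those with `c_t < 0`). -/
def IsLPChoice (A : P.Adversary) (X : P.Arrival → ℕ → ℕ → ℝ) : Prop :=
  ∀ I, ∀ t ∈ Finset.Icc 1 P.n, (∃ y, P.LPFeasible (A.W I) t y) →
    P.LPOptimal (A.V I) (A.W I) t (X I t)

open Classical in
/-- The selection `X^alg_t ∈ {0, 1}` of the algorithm at time `t`, for sizes `W` and LP solutions
`X`: the item is picked iff it is tentatively picked (`X^t_t > 0`) and the past selections satisfy
the main budget and the outer constraint for the window containing `t`. -/
def algSel (a₄ : ℝ) (W : ℕ → ℝ) (X : ℕ → ℕ → ℝ) (t : ℕ) : ℝ :=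
  if 0 < X t t ∧
      ∑ s ∈ ((Finset.Ico 1 t).filter fun s => P.window s = P.window t).attach,
        W s * algSel a₄ W X s ≤ a₄ * (P.ℓ / P.n) * P.k - 1 ∧
      ∑ s ∈ (Finset.Ico 1 t).attach, W s * algSel a₄ W X s ≤ P.k - 1
  then 1 else 0
termination_by t
decreasing_by
  · exact (Finset.mem_Ico.1 (Finset.mem_filter.1 s.2).1).2
  · exact (Finset.mem_Ico.1 s.2).2

open Classical in
/-- The indicator `T_t` of a tentative selection. -/
def T (X : ℕ → ℕ → ℝ) (t : ℕ) : ℝ := if 0 < X t t then 1 else 0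

open Classical in
/-- The indicator `F_t` of not being blocked at time `t`. -/
def F (a₄ : ℝ) (W : ℕ → ℝ) (X : ℕ → ℕ → ℝ) (t : ℕ) : ℝ :=
  if ∑ s ∈ Finset.Ico 1 t with P.window s = P.window t, W s * P.algSel a₄ W X s
        ≤ a₄ * (P.ℓ / P.n) * P.k - 1 ∧
      ∑ s ∈ Finset.Ico 1 t, W s * P.algSel a₄ W X s ≤ P.k - 1
  then 1 else 0

/-- `X^alg_t = T_t F_t`. -/
theorem algSel_eq (a₄ : ℝ) (W : ℕ → ℝ) (X : ℕ → ℕ → ℝ) (t : ℕ) :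
    P.algSel a₄ W X t = T X t * P.F a₄ W X t := by
  rw [algSel, T, F]
  rw [Finset.sum_attach (Finset.Ico 1 t) (fun s => W s * P.algSel a₄ W X s),
    Finset.sum_attach ((Finset.Ico 1 t).filter fun s => P.window s = P.window t)
      (fun s => W s * P.algSel a₄ W X s)]
  split_ifs <;> simp_all

/-- The offline fractional optimum over the random-order items. -/
def OPT : ℝ :=
  sSup {y : ℝ | ∃ x : Fin P.RO.card → ℝ, (∀ i, x i ∈ Set.Icc (0 : ℝ) 1) ∧
    ∑ i, P.w i * x i ≤ P.k ∧ y = ∑ i, P.v i * x i}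

/-- The error term `ε_t`. -/
def ε (t : ℕ) : ℝ :=
  (a₁ + 3) * (P.Γ * P.ℓ / t) + Real.sqrt (10 * Real.log P.k) * Real.sqrt (2 * P.n / (t * P.k))

open Classical in
/-- The blocking bound `p_t = C / (k (1 - t/n - a₅ Γ ln k / k)²)`, meant for positive
`1 - t/n - a₅ Γ ln k / k`; at the remaining, late times it is the trivial bound `1`. -/
def p (C a₅ : ℝ) (t : ℕ) : ℝ :=
  if 0 < 1 - t / P.n - a₅ * (P.Γ * Real.log P.k / P.k) then
    C / (P.k * (1 - t / P.n - a₅ * (P.Γ * Real.log P.k / P.k)) ^ 2)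
  else 1

end

end BARO

/-! Fix `b` and call an item dense if it is among the densest items of total size about `b`. An
arrival order samples the items without replacement; a moment generating function bound shows that
its partial sums, conditioned on the item at time `t`, concentrate like sums of independent
samples. So in most arrival orders the dense items arrive at about the expected rate, overall and
in every window.

*Not blocked.* Moving fractional mass from a selected item to a denser one shows that an optimal
solution of `LP_t` never selects an item if the denser ones, though respecting the window budgets,
overfill the main budget. So, for `b = k`, as long as the dense items do not arrive too slowly, all
items selected outside the adversarial and the first few windows are dense. For the algorithm to be
blocked at `t` nevertheless, the dense items must fill a window or the knapsack ahead of schedule,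
which is unlikely.

*Tentatively selected.* Conversely, if the solution of `LP_t` omits the item at time `t`, then
earlier items at least as dense fill the window of `t` or the main budget. If the item is dense for
`b = (c_t - ε_t) k`, then so are these items, and by concentration this has probability at most
`2 / k`. By the greedy bound for the fractional knapsack, the dense items for this `b` carry at
least `(c_t - ε_t) OPT` of the value. -/

section ExponentialBounds

open Finset
open scoped BigOperators

theorem exp_mul_le_one_add {x : ℝ} (hx : x ∈ Set.Icc (0 : ℝ) 1) (r : ℝ) :
    Real.exp (r * x) ≤ 1 + x * (Real.exp r - 1) := by
  have convex := convexOn_exp.2 (Set.mem_univ (0 : ℝ)) (Set.mem_univ r)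
    (sub_nonneg.2 hx.2) hx.1 (by ring)
  simp only [smul_eq_mul, mul_zero, zero_add, Real.exp_zero, mul_one] at convex
  rw [mul_comm r]
  linarith

theorem expect_exp_mul_le {ι : Type*} (s : Finset ι) {f : ι → ℝ}
    (hf : ∀ b, f b ∈ Set.Icc (0 : ℝ) 1) (r : ℝ) :
    𝔼 b ∈ s, Real.exp (r * f b) ≤ Real.exp ((𝔼 b ∈ s, f b) * (Real.exp r - 1)) := by
  rcases s.eq_empty_or_nonempty with rfl | hs
  · simp
  · calc 𝔼 b ∈ s, Real.exp (r * f b)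
        ≤ 𝔼 b ∈ s, (1 + f b * (Real.exp r - 1)) :=
          expect_le_expect fun b _ => exp_mul_le_one_add (hf b) r
      _ = (𝔼 b ∈ s, f b) * (Real.exp r - 1) + 1 := by
          rw [expect_add_distrib, expect_const hs, expect_mul, add_comm]
      _ ≤ _ := Real.add_one_le_exp _

theorem exp_sub_one_le_add_sq {r : ℝ} (hr : 0 ≤ r) (hr1 : r ≤ 1) : Real.exp r - 1 ≤ r + r ^ 2 := by
  have h := Real.abs_exp_sub_one_sub_id_le (x := r) (by rwa [abs_of_nonneg hr])
  linarith [(abs_le.1 h).2]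

theorem exp_neg_sub_one_le {r : ℝ} (hr : 0 ≤ r) : Real.exp (-r) - 1 ≤ -r + r ^ 2 / 2 := by
  have quadratic := Real.quadratic_le_exp_of_nonneg hr
  have pos : 0 < 1 + r + r ^ 2 / 2 := by positivity
  calc Real.exp (-r) - 1
      ≤ (1 + r + r ^ 2 / 2)⁻¹ - 1 := by
        rw [Real.exp_neg]
        gcongr
    _ ≤ -r + r ^ 2 / 2 := by
        rw [sub_le_iff_le_add, inv_le_iff_one_le_mul₀ pos]
        nlinarith [sq_nonneg (r ^ 2)]

end ExponentialBounds

section RandomBijection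

open Finset
open scoped BigOperators

variable {α β : Type*} [DecidableEq α]

theorem prod_comp_swap {a c : α} {S : Finset α} (haS : a ∉ S) (hcS : c ∉ S) (g : α → ℝ) :
    ∏ s ∈ S, g (Equiv.swap a c s) = ∏ s ∈ S, g s :=
  prod_congr rfl fun s hs => by
    rw [Equiv.swap_apply_of_ne_of_ne (ne_of_mem_of_not_mem hs haS) (ne_of_mem_of_not_mem hs hcS)]

variable [Fintype α] [Fintype β] [DecidableEq β]

theorem expect_bijection_swap_trans {t a c : α} (i : β) (hat : a ≠ t) (hct : c ≠ t)
    (Φ : (α ≃ β) → ℝ) :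
    𝔼 I : α ≃ β with I t = i, Φ ((Equiv.swap a c).trans I) =
      𝔼 I : α ≃ β with I t = i, Φ I := by
  have hswap (I : α ≃ β) : (Equiv.swap a c).trans ((Equiv.swap a c).trans I) = I := by
    ext s
    simp
  refine expect_nbij' ((Equiv.swap a c).trans ·) ((Equiv.swap a c).trans ·) ?_ ?_
    (fun I _ => hswap I) (fun I _ => hswap I) fun _ _ => rfl <;>
  · intro I hI
    simpa [Equiv.swap_apply_of_ne_of_ne hat.symm hct.symm] using hI

theorem expect_bijection_mul_prod_le {g : β → ℝ} (hg : ∀ b, 0 ≤ g b) {t a c : α} (i : β)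
    {S : Finset α} (hat : a ≠ t) (hct : c ≠ t) (haS : a ∉ S) :
    𝔼 I : α ≃ β with I t = i, g (I a) * ∏ s ∈ S, g (I s) ≤
      𝔼 I : α ≃ β with I t = i, g (I c) * ∏ s ∈ S, g (I s) := by
  by_cases hcS : c ∈ S
  · -- `swap a c` preserves the law of `I`, so this is AM-GM for `g (I a)` and `g (I c)`.
    have haR : a ∉ S.erase c := fun h => haS (mem_of_mem_erase h)
    have hcR : c ∉ S.erase c := notMem_erase c S
    have swapped := expect_bijection_swap_trans i hat hct
      fun I => g (I c) ^ 2 * ∏ s ∈ S.erase c, g (I s)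
    have fixed (I : α ≃ β) := prod_comp_swap haR hcR fun s => g (I s)
    simp only [Equiv.trans_apply, Equiv.swap_apply_right, fixed] at swapped
    have am_gm : 2 * (𝔼 I : α ≃ β with I t = i,
          g (I a) * (g (I c) * ∏ s ∈ S.erase c, g (I s))) ≤
        (𝔼 I : α ≃ β with I t = i, g (I a) ^ 2 * ∏ s ∈ S.erase c, g (I s)) +
          𝔼 I : α ≃ β with I t = i, g (I c) ^ 2 * ∏ s ∈ S.erase c, g (I s) := by
      rw [mul_expect, ← expect_add_distrib]
      refine expect_le_expect fun I _ => ?_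
      nlinarith [mul_nonneg (prod_nonneg fun s (_ : s ∈ S.erase c) => hg (I s))
        (sq_nonneg (g (I a) - g (I c)))]
    simp only [← mul_prod_erase S _ hcS, sq, mul_assoc] at swapped am_gm ⊢
    linarith
  · have swapped := expect_bijection_swap_trans i hat hct fun I => g (I c) * ∏ s ∈ S, g (I s)
    have fixed (I : α ≃ β) := prod_comp_swap haS hcS fun s => g (I s)
    simp only [Equiv.trans_apply, Equiv.swap_apply_right, fixed] at swapped
    exact swapped.le

theorem expect_erase_comp_bijection (I : α ≃ β) (t : α) (g : β → ℝ) :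
    𝔼 c ∈ univ.erase t, g (I c) = 𝔼 b ∈ univ.erase (I t), g b :=
  expect_nbij' I I.symm (by simp) (by simp [Equiv.symm_apply_eq]) (by simp) (by simp)
    fun _ _ => rfl

theorem expect_bijection_prod_insert_le {g : β → ℝ} (hg : ∀ b, 0 ≤ g b) {t a : α} (i : β)
    {S : Finset α} (hat : a ≠ t) (haS : a ∉ S) :
    𝔼 I : α ≃ β with I t = i, ∏ s ∈ insert a S, g (I s) ≤
      (𝔼 b ∈ univ.erase i, g b) * 𝔼 I : α ≃ β with I t = i, ∏ s ∈ S, g (I s) := by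
  -- Among all `c ≠ t`, positions outside `S` give the least expectation, hence at most the average.
  simp only [prod_insert haS]
  refine (le_expect ⟨a, mem_erase.2 ⟨hat, mem_univ a⟩⟩ fun c hc =>
    expect_bijection_mul_prod_le hg i hat (ne_of_mem_erase hc) haS).trans_eq ?_
  rw [expect_comm, mul_expect]
  refine expect_congr rfl fun I hI => ?_
  rw [← expect_mul, expect_erase_comp_bijection, (mem_filter.1 hI).2]

theorem expect_bijection_prod_le {g : β → ℝ} (hg : ∀ b, 0 ≤ g b) {t : α} (i : β)
    {S : Finset α} (htS : t ∉ S) :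
    𝔼 I : α ≃ β with I t = i, ∏ s ∈ S, g (I s) ≤ (𝔼 b ∈ univ.erase i, g b) ^ #S := by
  induction S using Finset.induction_on with
  | empty =>
    rcases (univ.filter fun I : α ≃ β => I t = i).eq_empty_or_nonempty with h | h
    · simp [h]
    · simp [expect_const h]
  | insert a S haS ih =>
    rw [mem_insert, not_or] at htS
    rw [card_insert_of_notMem haS, pow_succ']
    exact (expect_bijection_prod_insert_le hg i (Ne.symm htS.1) haS).trans
      (mul_le_mul_of_nonneg_left (ih htS.2) (expect_nonneg fun b _ => hg b))

theorem expect_bijection_exp_sum_le {f : β → ℝ} (hf : ∀ b, f b ∈ Set.Icc (0 : ℝ) 1) {t : α}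
    (i : β) {S : Finset α} (htS : t ∉ S) (r : ℝ) :
    𝔼 I : α ≃ β with I t = i, Real.exp (r * ∑ s ∈ S, f (I s)) ≤
      Real.exp (#S * (𝔼 b ∈ univ.erase i, f b) * (Real.exp r - 1)) := by
  simp only [mul_sum, Real.exp_sum]
  refine (expect_bijection_prod_le (g := fun b => Real.exp (r * f b))
    (fun b => (Real.exp_pos _).le) i htS).trans ?_
  rw [mul_assoc, Real.exp_nat_mul]
  exact pow_le_pow_left₀ (expect_nonneg fun b _ => (Real.exp_pos _).le) (expect_exp_mul_le _ hf r) _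

section Chernoff

variable {f : β → ℝ} (hf : ∀ b, f b ∈ Set.Icc (0 : ℝ) 1) {t : α} (i : β) {S : Finset α}
  (htS : t ∉ S)

include hf htS

theorem expect_bijection_indicator_le_exp {E : (α ≃ β) → Prop} [DecidablePred E] {r a : ℝ}
    (hE : ∀ I, E I → r * a ≤ r * ∑ s ∈ S, f (I s)) :
    𝔼 I : α ≃ β with I t = i, (if E I then (1 : ℝ) else 0) ≤
      Real.exp (#S * (𝔼 b ∈ univ.erase i, f b) * (Real.exp r - 1) - r * a) := by
  calc 𝔼 I : α ≃ β with I t = i, (if E I then (1 : ℝ) else 0)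
      ≤ 𝔼 I : α ≃ β with I t = i, Real.exp (r * ∑ s ∈ S, f (I s)) * Real.exp (-(r * a)) := by
        refine expect_le_expect fun I _ => ?_
        rw [← Real.exp_add]
        split_ifs with h
        · exact Real.one_le_exp (by linarith [hE I h])
        · exact (Real.exp_pos _).le
    _ ≤ _ := by
        rw [← expect_mul, sub_eq_add_neg _ (r * a), Real.exp_add]
        exact mul_le_mul_of_nonneg_right (expect_bijection_exp_sum_le hf i htS r)
          (Real.exp_pos _).le

theorem expect_bijection_le_sum_le_exp {M : ℝ} (hM : #S * (𝔼 b ∈ univ.erase i, f b) ≤ M) (a : ℝ) :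
    𝔼 I : α ≃ β with I t = i, (if a ≤ ∑ s ∈ S, f (I s) then (1 : ℝ) else 0) ≤
      Real.exp (2 * M - a) := by
  have mean_nonneg : 0 ≤ #S * (𝔼 b ∈ univ.erase i, f b) :=
    mul_nonneg (Nat.cast_nonneg _) (expect_nonneg fun b _ => (hf b).1)
  refine (expect_bijection_indicator_le_exp hf i htS (r := 1) (a := a) fun I h => by
    simpa using h).trans (Real.exp_le_exp.2 ?_)
  nlinarith [Real.exp_one_lt_d9]

theorem expect_bijection_add_le_sum_le_exp {M K D : ℝ}
    (hM : #S * (𝔼 b ∈ univ.erase i, f b) ≤ M) (hMK : M ≤ K) (hD : 0 ≤ D) (hDK : D ≤ 2 * K) :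
    𝔼 I : α ≃ β with I t = i, (if M + D ≤ ∑ s ∈ S, f (I s) then (1 : ℝ) else 0) ≤
      Real.exp (-(D ^ 2 / (4 * K))) := by
  rcases (show 0 ≤ K by linarith).eq_or_lt with rfl | hK
  · obtain rfl : D = 0 := by linarith
    simpa using expect_bijection_indicator_le_exp hf i htS (r := 0) (a := M) (by simp)
  set r := D / (2 * K) with hr
  have r_nonneg : 0 ≤ r := by positivity
  have r_le_one : r ≤ 1 := by rwa [hr, div_le_one (by positivity)]
  refine (expect_bijection_indicator_le_exp hf i htS fun I h =>
    mul_le_mul_of_nonneg_left h r_nonneg).trans (Real.exp_le_exp.2 ?_)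
  have mean_nonneg : 0 ≤ #S * (𝔼 b ∈ univ.erase i, f b) :=
    mul_nonneg (Nat.cast_nonneg _) (expect_nonneg fun b _ => (hf b).1)
  calc #S * (𝔼 b ∈ univ.erase i, f b) * (Real.exp r - 1) - r * (M + D)
      ≤ M * (r + r ^ 2) - r * (M + D) := by
        gcongr
        · linarith [Real.add_one_le_exp r]
        · linarith
        · exact exp_sub_one_le_add_sq r_nonneg r_le_one
    _ ≤ K * r ^ 2 - r * D := by nlinarith [sq_nonneg r]
    _ = -(D ^ 2 / (4 * K)) := by
        rw [hr]
        field_simp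
        ring

theorem expect_bijection_sum_le_le_exp {M K a : ℝ}
    (hM : M ≤ #S * (𝔼 b ∈ univ.erase i, f b)) (hM0 : 0 ≤ M) (hMK : M ≤ K) (ha : a ≤ M) :
    𝔼 I : α ≃ β with I t = i, (if ∑ s ∈ S, f (I s) ≤ a then (1 : ℝ) else 0) ≤
      Real.exp (-((M - a) ^ 2 / (2 * K))) := by
  rcases (hM0.trans hMK).eq_or_lt with rfl | hK
  · simpa using expect_bijection_indicator_le_exp hf i htS (r := 0) (a := M) (by simp)
  set r := (M - a) / K with hr
  have r_nonneg : 0 ≤ r := div_nonneg (by linarith) hK.le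
  refine (expect_bijection_indicator_le_exp hf i htS (r := -r) fun I h =>
    mul_le_mul_of_nonpos_left h (by linarith)).trans (Real.exp_le_exp.2 ?_)
  calc #S * (𝔼 b ∈ univ.erase i, f b) * (Real.exp (-r) - 1) - -r * a
      ≤ M * (Real.exp (-r) - 1) + r * a := by
        nlinarith [Real.exp_le_one_iff.2 (neg_nonpos.2 r_nonneg)]
    _ ≤ M * (-r + r ^ 2 / 2) + r * a := by
        gcongr
        exact exp_neg_sub_one_le r_nonneg
    _ ≤ K * r ^ 2 / 2 - r * (M - a) := by nlinarith [sq_nonneg r]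
    _ = -((M - a) ^ 2 / (2 * K)) := by
        rw [hr]
        field_simp
        ring

end Chernoff

theorem card_mul_card_bijection_fiber (t : α) (i : β) :
    Fintype.card β * #{I : α ≃ β | I t = i} = Fintype.card (α ≃ β) := by
  have fiber_card (j : β) : #{I : α ≃ β | I t = j} = #{I : α ≃ β | I t = i} :=
    card_nbij' (fun I => I.trans (Equiv.swap i j)) (fun I => I.trans (Equiv.swap i j))
      (fun I hI => by simp [(mem_filter.1 hI).2]) (fun I hI => by simp [(mem_filter.1 hI).2])
      (fun I _ => by ext; simp) (fun I _ => by ext; simp)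
  have fibers := card_eq_sum_card_fiberwise (s := univ) (f := fun I : α ≃ β => I t) (t := univ)
    (by simp)
  rw [← card_univ (α := α ≃ β), fibers, sum_congr rfl fun j _ => fiber_card j, sum_const,
    card_univ, smul_eq_mul]

theorem expect_expect_bijection_fiber (t : α) (f : (α ≃ β) → ℝ) :
    𝔼 i, 𝔼 I : α ≃ β with I t = i, f I = 𝔼 I, f I := by
  have fiber_expect (i : β) : (𝔼 I : α ≃ β with I t = i, f I) / Fintype.card β =
      (∑ I : α ≃ β with I t = i, f I) / Fintype.card (α ≃ β) := by
    rw [expect_eq_sum_div_card, div_div, mul_comm, ← card_mul_card_bijection_fiber t i,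
      Nat.cast_mul]
  rw [Fintype.expect_eq_sum_div_card, Fintype.expect_eq_sum_div_card, sum_div,
    sum_congr rfl fun i _ => fiber_expect i, ← sum_div, sum_fiberwise]

end RandomBijection

open Finset in
theorem sum_le_sum_add_sum_filter_notMem {ι κ : Type*} [DecidableEq κ] {S : Finset ι} {g : ι → κ}
    {y : ι → ℝ} {B : κ → ℝ} (J : Finset κ) (hB : ∀ j ∈ J, ∑ s ∈ S with g s = j, y s ≤ B j) :
    ∑ s ∈ S, y s ≤ ∑ j ∈ J, B j + ∑ s ∈ S with g s ∉ J, y s := by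
  have inside : ∑ s ∈ S with g s ∈ J, y s ≤ ∑ j ∈ J, B j := by
    rw [← sum_fiberwise_of_maps_to (s := S.filter (g · ∈ J)) fun s hs => (mem_filter.1 hs).2]
    refine sum_le_sum fun j hj => (hB j hj).trans_eq' ?_
    rw [filter_filter]
    refine sum_congr (filter_congr fun s _ => ?_) fun _ _ => rfl
    exact (and_iff_right_of_imp fun h : g s = j => h.symm ▸ hj).symm
  rw [← sum_filter_add_sum_filter_not S (g · ∈ J)]
  exact add_le_add_left inside _

open Topology in
theorem eventually_add_mul_le {a b d : ℝ} (hab : a ≤ b) (hd : a = b → d ≤ 0) :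
    ∀ᶠ η in 𝓝[>] (0 : ℝ), a + η * d ≤ b := by
  rcases hab.eq_or_lt with rfl | hlt
  · filter_upwards [self_mem_nhdsWithin] with η hη
    nlinarith [hd rfl, Set.mem_Ioi.1 hη]
  · have cont : Filter.Tendsto (fun η : ℝ => a + η * d) (𝓝[>] 0) (𝓝 (a + 0 * d)) :=
      (Continuous.tendsto (by fun_prop) 0).mono_left nhdsWithin_le_nhds
    exact (cont.eventually_lt_const (by simpa using hlt)).mono fun _ => le_of_lt

/-- A fractional knapsack linear program in which, besides the main budget, every group of items
has a budget of its own. The programs `LP_t` are of this form, the groups being the windows. -/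
structure GroupedKnapsack (ι κ : Type*) where
  items : Finset ι
  group : ι → κ
  size : ι → ℝ
  value : ι → ℝ
  budget : ℝ
  groupBudget : κ → ℝ

namespace GroupedKnapsack

open Finset Topology

section Definitions

variable {ι κ : Type*} [DecidableEq κ]

/-- Feasibility of a fractional selection `x`; its entries outside `K.items` are ignored. -/
def IsFeasible (K : GroupedKnapsack ι κ) (x : ι → ℝ) : Prop :=
  (∀ s ∈ K.items, x s ∈ Set.Icc (0 : ℝ) 1) ∧
  ∑ s ∈ K.items, K.size s * x s ≤ K.budget ∧
  ∀ j, ∑ s ∈ K.items with K.group s = j, K.size s * x s ≤ K.groupBudget j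

/-- Optimality of a fractional selection `x`. -/
def IsOptimal (K : GroupedKnapsack ι κ) (x : ι → ℝ) : Prop :=
  K.IsFeasible x ∧ ∀ y, K.IsFeasible y →
    ∑ s ∈ K.items, K.value s * y s ≤ ∑ s ∈ K.items, K.value s * x s

/-- The budget of the group `j` is not used up by the fractional selection `x`. -/
def GroupSlack (K : GroupedKnapsack ι κ) (x : ι → ℝ) (j : κ) : Prop :=
  ∑ s ∈ K.items with K.group s = j, K.size s * x s < K.groupBudget j

end Definitions

variable {ι κ : Type*} [DecidableEq κ] {K : GroupedKnapsack ι κ} {x : ι → ℝ}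

theorem IsFeasible.eventually_isFeasible_add_mul (hx : K.IsFeasible x) {d : ι → ℝ}
    (h0 : ∀ s ∈ K.items, x s = 0 → 0 ≤ d s) (h1 : ∀ s ∈ K.items, x s = 1 → d s ≤ 0)
    (hbudget : ∑ s ∈ K.items, K.size s * x s = K.budget → ∑ s ∈ K.items, K.size s * d s ≤ 0)
    (hgroup : ∀ j, ¬K.GroupSlack x j → ∑ s ∈ K.items with K.group s = j, K.size s * d s ≤ 0) :
    ∀ᶠ η in 𝓝[>] (0 : ℝ), K.IsFeasible fun s => x s + η * d s := by
  obtain ⟨box, main, groups⟩ := hx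
  have lower : ∀ᶠ η in 𝓝[>] (0 : ℝ), ∀ s ∈ K.items, -x s + η * -d s ≤ 0 :=
    (Filter.eventually_all_finset _).2 fun s hs =>
      eventually_add_mul_le (by linarith [(box s hs).1])
        fun h => by linarith [h0 s hs (by linarith)]
  have upper : ∀ᶠ η in 𝓝[>] (0 : ℝ), ∀ s ∈ K.items, x s + η * d s ≤ 1 :=
    (Filter.eventually_all_finset _).2 fun s hs => eventually_add_mul_le (box s hs).2 (h1 s hs)
  have group_le : ∀ᶠ η in 𝓝[>] (0 : ℝ), ∀ j ∈ K.items.image K.group,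
      ∑ s ∈ K.items with K.group s = j, K.size s * x s +
        η * ∑ s ∈ K.items with K.group s = j, K.size s * d s ≤ K.groupBudget j :=
    (Filter.eventually_all_finset _).2 fun j _ => eventually_add_mul_le (groups j) fun h =>
      hgroup j h.not_lt
  filter_upwards [lower, upper, eventually_add_mul_le main hbudget, group_le]
    with η lower upper main_le group_le
  have sum_add (S : Finset ι) : ∑ s ∈ S, K.size s * (x s + η * d s) =
      ∑ s ∈ S, K.size s * x s + η * ∑ s ∈ S, K.size s * d s := by
    rw [mul_sum, ← sum_add_distrib]
    exact sum_congr rfl fun s _ => by ring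
  refine ⟨fun s hs => ⟨by linarith [lower s hs], upper s hs⟩, (sum_add _).trans_le main_le,
    fun j => ?_⟩
  by_cases hj : j ∈ K.items.image K.group
  · exact (sum_add _).trans_le (group_le j hj)
  · have empty : K.items.filter (K.group · = j) = ∅ :=
      filter_eq_empty_iff.2 fun s hs h => hj (h ▸ mem_image_of_mem _ hs)
    simpa only [empty, sum_empty] using groups j

theorem IsOptimal.sum_value_mul_nonpos (hx : K.IsOptimal x) {d : ι → ℝ}
    (h0 : ∀ s ∈ K.items, x s = 0 → 0 ≤ d s) (h1 : ∀ s ∈ K.items, x s = 1 → d s ≤ 0)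
    (hbudget : ∑ s ∈ K.items, K.size s * x s = K.budget → ∑ s ∈ K.items, K.size s * d s ≤ 0)
    (hgroup : ∀ j, ¬K.GroupSlack x j → ∑ s ∈ K.items with K.group s = j, K.size s * d s ≤ 0) :
    ∑ s ∈ K.items, K.value s * d s ≤ 0 := by
  obtain ⟨η, feasible, hη⟩ :=
    ((hx.1.eventually_isFeasible_add_mul h0 h1 hbudget hgroup).and self_mem_nhdsWithin).exists
  have better := hx.2 _ feasible
  simp only [mul_add, sum_add_distrib, mul_left_comm _ η, ← mul_sum] at better
  nlinarith

theorem IsOptimal.value_mul_size_le (hx : K.IsOptimal x) {r s : ι} (hr : r ∈ K.items)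
    (hs : s ∈ K.items) (hWr : 0 ≤ K.size r) (hWs : 0 ≤ K.size s) (hxr : 0 < x r) (hxs : x s < 1)
    (hgroup : K.group r = K.group s ∨ K.GroupSlack x (K.group s)) :
    K.value s * K.size r ≤ K.value r * K.size s := by
  classical
  rcases eq_or_ne r s with rfl | hrs
  · rfl
  have shift (S : Finset ι) (U : ι → ℝ) :
      ∑ u ∈ S, U u * ((Pi.single s (K.size r) - Pi.single r (K.size s) : ι → ℝ) u) =
        (if s ∈ S then U s * K.size r else 0) - (if r ∈ S then U r * K.size s else 0) := by
    simp only [Pi.sub_apply, mul_sub, sum_sub_distrib, Pi.single_apply, mul_ite, mul_zero,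
      sum_ite_eq']
  have no_gain := hx.sum_value_mul_nonpos
    (d := Pi.single s (K.size r) - Pi.single r (K.size s)) ?_ ?_ ?_ ?_
  · rw [shift, if_pos hs, if_pos hr] at no_gain
    linarith
  · intro u _ hu
    have hur : u ≠ r := by rintro rfl; exact hxr.ne' hu
    rw [Pi.sub_apply, Pi.single_eq_of_ne hur, sub_zero, Pi.single_apply]
    split_ifs <;> simp [hWr]
  · intro u _ hu
    have hus : u ≠ s := by rintro rfl; exact hxs.ne hu
    rw [Pi.sub_apply, Pi.single_eq_of_ne hus, zero_sub, Pi.single_apply]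
    split_ifs <;> simp [hWs]
  · intro _
    rw [shift, if_pos hs, if_pos hr, mul_comm, sub_self]
  · intro j hj
    rw [shift]
    simp only [mem_filter, hs, hr, true_and]
    split_ifs with hsj hrj
    · exact (by ring : _ = (0 : ℝ)).le
    · subst hsj
      exact (hgroup.elim hrj hj).elim
    · rw [zero_sub, neg_nonpos]
      positivity
    · simp

theorem IsOptimal.budget_le_sum (hx : K.IsOptimal x) {s : ι} (hs : s ∈ K.items)
    (hV : 0 < K.value s) (hxs : x s < 1) (hgroup : K.GroupSlack x (K.group s)) :
    K.budget ≤ ∑ u ∈ K.items, K.size u * x u := by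
  classical
  by_contra hlt
  have single (S : Finset ι) (U : ι → ℝ) :
      ∑ u ∈ S, U u * (Pi.single s 1 : ι → ℝ) u = if s ∈ S then U s else 0 := by
    simp only [Pi.single_apply, mul_ite, mul_one, mul_zero, sum_ite_eq']
  have no_gain := hx.sum_value_mul_nonpos (d := Pi.single s 1) ?_ ?_ (fun h => (hlt h.ge).elim) ?_
  · rw [single, if_pos hs] at no_gain
    linarith
  · intro u _ _
    rw [Pi.single_apply]
    split_ifs <;> simp
  · intro u _ hu
    have hus : u ≠ s := by rintro rfl; exact hxs.ne hu
    rw [Pi.single_eq_of_ne hus]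
  · intro j hj
    have hsj : K.group s ≠ j := by rintro rfl; exact hj hgroup
    rw [single, if_neg (by simp [hsj])]

theorem IsOptimal.sum_size_denser_le (hx : K.IsOptimal x) (hW : ∀ s ∈ K.items, 0 ≤ K.size s)
    {t : ι} (ht : t ∈ K.items) (hxt : 0 < x t) {D : Finset ι} (hD : D ⊆ K.items)
    (denser : ∀ s ∈ D, K.value t * K.size s < K.value s * K.size t)
    (hgroup : ∀ j, ∑ s ∈ D with K.group s = j, K.size s ≤ K.groupBudget j) :
    ∑ s ∈ D, K.size s ≤ K.budget := by
  have group_le (j : κ) : ∑ s ∈ D with K.group s = j, K.size s ≤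
      ∑ s ∈ K.items with K.group s = j, K.size s * x s := by
    by_cases slack : K.GroupSlack x j
    · have full : ∀ s ∈ D, K.group s = j → x s = 1 := fun s hs hj => by
        by_contra hne
        exact (denser s hs).not_ge (hx.value_mul_size_le ht (hD hs) (hW t ht) (hW s (hD hs)) hxt
          ((hx.1.1 s (hD hs)).2.lt_of_ne hne) (Or.inr (hj ▸ slack)))
      calc ∑ s ∈ D with K.group s = j, K.size s
          = ∑ s ∈ D with K.group s = j, K.size s * x s :=
            sum_congr rfl fun s hs => by
              rw [full s (mem_filter.1 hs).1 (mem_filter.1 hs).2, mul_one]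
        _ ≤ _ := sum_le_sum_of_subset_of_nonneg (filter_subset_filter _ hD) fun s hs _ =>
            mul_nonneg (hW s (mem_filter.1 hs).1) (hx.1.1 s (mem_filter.1 hs).1).1
    · exact (hgroup j).trans (not_lt.1 slack)
  have maps : ∀ s ∈ K.items, K.group s ∈ K.items.image K.group := fun s => mem_image_of_mem _
  rw [← sum_fiberwise_of_maps_to fun s hs => maps s (hD hs)]
  refine (sum_le_sum fun j _ => group_le j).trans ?_
  rw [sum_fiberwise_of_maps_to maps]
  exact hx.1.2.1

variable [DecidableEq ι]

open Classical in
/-- The items other than `t` that are at least as dense as `t`: those for which an optimal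
solution may leave out `t`. -/
noncomputable def rivals (K : GroupedKnapsack ι κ) (t : ι) : Finset ι :=
  {s ∈ K.items.erase t | K.value t * K.size s ≤ K.value s * K.size t}

theorem IsOptimal.sum_mul_le_sum_rivals (hx : K.IsOptimal x) (hW : ∀ s ∈ K.items, 0 ≤ K.size s)
    {t : ι} (ht : t ∈ K.items) (hxt : x t = 0) (q : ι → Prop) [DecidablePred q]
    (hq : ∀ s ∈ K.items, q s → K.group s = K.group t ∨ K.GroupSlack x (K.group t)) :
    ∑ s ∈ K.items with q s, K.size s * x s ≤ ∑ s ∈ K.rivals t with q s, K.size s := by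
  have selected_rival : ∀ s ∈ K.items, q s → x s ≠ 0 → s ∈ K.rivals t := fun s hs hqs hxs => by
    refine mem_filter.2 ⟨mem_erase.2 ⟨by rintro rfl; exact hxs hxt, hs⟩, ?_⟩
    exact hx.value_mul_size_le hs ht (hW s hs) (hW t ht) ((hx.1.1 s hs).1.lt_of_ne' hxs)
      (by simp [hxt]) (hq s hs hqs)
  calc ∑ s ∈ K.items with q s, K.size s * x s
      = ∑ s ∈ K.items with q s ∧ x s ≠ 0, K.size s * x s := by
        rw [← filter_filter]
        refine (sum_filter_of_ne fun s _ h => right_ne_zero_of_mul h).symm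
    _ ≤ ∑ s ∈ K.items with q s ∧ x s ≠ 0, K.size s := sum_le_sum fun s hs =>
        mul_le_of_le_one_right (hW s (mem_filter.1 hs).1) (hx.1.1 s (mem_filter.1 hs).1).2
    _ ≤ _ := by
        refine sum_le_sum_of_subset_of_nonneg (fun s hs => ?_) fun s hs _ =>
          hW s (mem_of_mem_erase (mem_filter.1 (mem_filter.1 hs).1).1)
        obtain ⟨hs, hqs, hxs⟩ := mem_filter.1 hs
        exact mem_filter.2 ⟨selected_rival s hs hqs hxs, hqs⟩

theorem IsOptimal.le_sum_rivals (hx : K.IsOptimal x) (hW : ∀ s ∈ K.items, 0 ≤ K.size s)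
    {t : ι} (ht : t ∈ K.items) (hV : 0 < K.value t) (hxt : x t = 0) (J : Finset κ) :
    K.groupBudget (K.group t) ≤ ∑ s ∈ K.rivals t with K.group s = K.group t, K.size s ∨
      K.budget - ∑ j ∈ J, K.groupBudget j ≤ ∑ s ∈ K.rivals t with K.group s ∉ J, K.size s := by
  by_cases slack : K.GroupSlack x (K.group t)
  · right
    linarith [hx.budget_le_sum ht hV (by simp [hxt]) slack,
      sum_le_sum_add_sum_filter_notMem J fun j _ => hx.1.2.2 j,
      hx.sum_mul_le_sum_rivals hW ht hxt (K.group · ∉ J) fun _ _ _ => Or.inr slack]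
  · left
    exact (not_lt.1 slack).trans
      (hx.sum_mul_le_sum_rivals hW ht hxt (K.group · = K.group t) fun _ _ => Or.inl)

end GroupedKnapsack

section DensestItems

open Finset

variable {ι : Type*} [Fintype ι] {v w : ι → ℝ} {b : ℝ}

open Classical in
/-- The densest items of total size about `b`, for values `v` and sizes `w`: those items whose
strictly denser items have total size less than `b`. -/
noncomputable def densestItems (v w : ι → ℝ) (b : ℝ) : Finset ι :=
  {i | ∑ j with v i / w i < v j / w j, w j < b}

theorem mem_densestItems_of_le (hw : ∀ i, 0 ≤ w i) {i j : ι} (hi : i ∈ densestItems v w b)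
    (hij : v i / w i ≤ v j / w j) : j ∈ densestItems v w b :=
  mem_filter.2 ⟨mem_univ j, (sum_le_sum_of_subset_of_nonneg
    (monotone_filter_right _ fun _ _ hu => hij.trans_lt hu) fun u _ _ => hw u).trans_lt
    (mem_filter.1 hi).2⟩

theorem le_sum_densestItems (hw : ∀ i, 0 ≤ w i) (hb : b ≤ ∑ i, w i) :
    b ≤ ∑ i ∈ densestItems v w b, w i := by
  classical
  by_cases h : ∃ i, i ∉ densestItems v w b
  · obtain ⟨m, hm, densest_outside⟩ := exists_max_image (univ.filter (· ∉ densestItems v w b))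
      (fun i => v i / w i) (by simpa [Finset.Nonempty] using h)
    simp only [mem_filter, mem_univ, true_and] at hm densest_outside
    calc b ≤ ∑ j with v m / w m < v j / w j, w j := by
          simpa [densestItems] using hm
      _ ≤ _ := sum_le_sum_of_subset_of_nonneg (fun u hu => by_contra fun hu' =>
          (mem_filter.1 hu).2.not_ge (densest_outside u hu')) fun u _ _ => hw u
  · push Not at h
    rwa [eq_univ_iff_forall.2 h]

theorem sum_densestItems_le (hw : ∀ i, w i ∈ Set.Icc (0 : ℝ) 1)
    (hinj : Function.Injective fun i => v i / w i) (hb : 0 ≤ b) :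
    ∑ i ∈ densestItems v w b, w i ≤ b + 1 := by
  classical
  rcases (densestItems v w b).eq_empty_or_nonempty with h | h
  · rw [h, sum_empty]
    linarith
  · obtain ⟨m, hm, least_dense⟩ := exists_min_image (densestItems v w b) (fun i => v i / w i) h
    have denser_lt : ∑ j with v m / w m < v j / w j, w j < b := (mem_filter.1 hm).2
    have erase_le : ∑ j ∈ (densestItems v w b).erase m, w j ≤
        ∑ j with v m / w m < v j / w j, w j := by
      refine sum_le_sum_of_subset_of_nonneg (fun u hu => ?_) fun u _ _ => (hw u).1
      obtain ⟨hum, hu⟩ := mem_erase.1 hu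
      exact mem_filter.2 ⟨mem_univ u, (least_dense u hu).lt_of_ne fun h => hum (hinj h).symm⟩
    rw [← sum_erase_add _ _ hm]
    linarith [(hw m).2]

theorem sum_mul_le_sum_densestItems (hv : ∀ i, 0 ≤ v i) (hw : ∀ i, 0 < w i) {x : ι → ℝ}
    (hx : ∀ i, x i ∈ Set.Icc (0 : ℝ) 1) (hsize : ∑ i, w i * x i ≤ b) (hb : b ≤ ∑ i, w i) :
    ∑ i, v i * x i ≤ ∑ i ∈ densestItems v w b, v i := by
  classical
  by_cases h : ∃ i, i ∉ densestItems v w b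
  · obtain ⟨m, hm, densest_outside⟩ := exists_max_image (univ.filter (· ∉ densestItems v w b))
      (fun i => v i / w i) (by simpa [Finset.Nonempty] using h)
    simp only [mem_filter, mem_univ, true_and] at hm densest_outside
    set τ := v m / w m
    have lagrangian (i : ι) : v i * x i ≤ (if i ∈ densestItems v w b then v i else 0) +
        τ * (w i * x i - if i ∈ densestItems v w b then w i else 0) := by
      split_ifs with hi
      · have denser : τ * w i ≤ v i := (le_div_iff₀ (hw i)).1 <| le_of_not_ge fun h =>
          hm (mem_densestItems_of_le (fun i => (hw i).le) hi h)
        nlinarith [(hx i).2]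
      · have sparser : v i ≤ τ * w i := (div_le_iff₀ (hw i)).1 (densest_outside i hi)
        nlinarith [(hx i).1]
    have total := sum_le_sum fun i (_ : i ∈ univ) => lagrangian i
    rw [sum_add_distrib, ← mul_sum, sum_sub_distrib, sum_ite_mem, sum_ite_mem,
      univ_inter] at total
    have filled : τ * (∑ i, w i * x i - ∑ i ∈ densestItems v w b, w i) ≤ 0 :=
      mul_nonpos_of_nonneg_of_nonpos (div_nonneg (hv m) (hw m).le)
        (by linarith [le_sum_densestItems (v := v) (fun i => (hw i).le) hb])
    linarith
  · push Not at h
    rw [eq_univ_iff_forall.2 h]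
    exact sum_le_sum fun i _ => mul_le_of_le_one_right (hv i) (hx i).2

end DensestItems

namespace BARO

open Finset
open scoped BigOperators

variable (P : BARO)

section Parameters

/-- The part `ℓ k / n` of the knapsack that a window is entitled to; it is about `ln k`. -/
noncomputable def windowBudget : ℝ := P.ℓ / P.n * P.k

theorem mul_windowBudget (a : ℝ) : a * (P.ℓ / P.n) * P.k = a * P.windowBudget := by
  rw [windowBudget, mul_assoc]

theorem k_pos : 0 < P.k := by linarith [P.k_ge]

theorem le_n : (160 : ℝ) ≤ P.n := by linarith [P.k_ge, P.k_le]

theorem n_pos : (0 : ℝ) < P.n := by linarith [P.le_n]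

theorem four_le_log_k : 4 ≤ Real.log P.k := by
  rw [Real.le_log_iff_exp_le P.k_pos]
  calc Real.exp 4 = Real.exp 1 ^ 4 := by
        rw [← Real.exp_nat_mul]
        norm_num
    _ ≤ 2.7182818286 ^ 4 := pow_le_pow_left₀ (Real.exp_pos 1).le Real.exp_one_lt_d9.le 4
    _ ≤ 80 := by norm_num
    _ ≤ P.k := P.k_ge

theorem abs_windowBudget_sub_log_le : |P.windowBudget - Real.log P.k| ≤ 1 / 2 := by
  have rounding : P.windowBudget - Real.log P.k =
      P.k / P.n * ((P.ℓ : ℝ) - P.n * Real.log P.k / P.k) := by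
    have hn := P.n_pos
    have hk := P.k_pos
    rw [windowBudget]
    field_simp
  have half : P.k / P.n ≤ 1 / 2 := (div_le_iff₀ P.n_pos).2 (by linarith [P.k_le])
  rw [rounding, abs_mul, abs_of_pos (div_pos P.k_pos P.n_pos)]
  exact (mul_le_mul half P.ℓ_round.le (abs_nonneg _) (by norm_num)).trans_eq (mul_one _)

theorem log_sub_half_le_windowBudget : Real.log P.k - 1 / 2 ≤ P.windowBudget := by
  linarith [(abs_le.1 P.abs_windowBudget_sub_log_le).1]

theorem windowBudget_le_log_add_half : P.windowBudget ≤ Real.log P.k + 1 / 2 := by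
  linarith [(abs_le.1 P.abs_windowBudget_sub_log_le).2]

theorem three_le_windowBudget : 3 ≤ P.windowBudget := by
  linarith [P.log_sub_half_le_windowBudget, P.four_le_log_k]

theorem ℓ_pos : 0 < P.ℓ := by
  refine Nat.pos_of_ne_zero fun h => ?_
  have hL := P.three_le_windowBudget
  norm_num [windowBudget, h] at hL

theorem three_mul_n_le : 3 * (P.n : ℝ) ≤ P.k * P.ℓ := by
  have hL := P.three_le_windowBudget
  rw [windowBudget, div_mul_eq_mul_div, le_div_iff₀ P.n_pos] at hL
  linarith

theorem eight_le_Γ : (8 : ℝ) ≤ P.Γ :=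
  (Real.le_sqrt_of_sq_le (by linarith [P.k_ge])).trans P.Γ_ge

theorem k_le_Γ_sq : P.k ≤ (P.Γ : ℝ) ^ 2 :=
  (Real.sqrt_le_left (Nat.cast_nonneg _)).1 P.Γ_ge

theorem four_mul_log_mul_k_le : 4 * Real.log P.k * P.k ≤ (2 * (P.Γ * P.windowBudget)) ^ 2 := by
  have k_pos := P.k_pos
  have log_le : Real.log P.k ≤ P.windowBudget ^ 2 := by
    nlinarith [P.log_sub_half_le_windowBudget, P.four_le_log_k]
  calc 4 * Real.log P.k * P.k ≤ 4 * P.windowBudget ^ 2 * P.Γ ^ 2 := by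
        gcongr
        exact P.k_le_Γ_sq
    _ = (2 * (P.Γ * P.windowBudget)) ^ 2 := by ring

variable {P} in
theorem mul_windowBudget_le_k {m : ℕ} (hm : m * P.ℓ ≤ P.n) : m * P.windowBudget ≤ P.k := by
  have le_one : (m : ℝ) * P.ℓ / P.n ≤ 1 := (div_le_one P.n_pos).2 (by exact_mod_cast hm)
  calc m * P.windowBudget = m * P.ℓ / P.n * P.k := by
        rw [windowBudget]
        ring
    _ ≤ P.k := mul_le_of_le_one_left P.k_pos.le le_one

end Parameters

section Windows

theorem window_lt_iff {s : ℕ} (hs : 1 ≤ s) (j : ℕ) : P.window s < j ↔ s ≤ j * P.ℓ := by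
  rw [window, Nat.div_lt_iff_lt_mul P.ℓ_pos]
  omega

theorem card_filter_window_eq_le {S : Finset ℕ} (hS : ∀ s ∈ S, 1 ≤ s) (j : ℕ) :
    #{s ∈ S | P.window s = j} ≤ P.ℓ := by
  calc #{s ∈ S | P.window s = j} ≤ #(Ioc (j * P.ℓ) ((j + 1) * P.ℓ)) := by
        refine card_le_card fun s hs => ?_
        obtain ⟨mem, rfl⟩ := mem_filter.1 hs
        rw [mem_Ioc, ← not_le, ← P.window_lt_iff (hS s mem), ← P.window_lt_iff (hS s mem)]
        omega
    _ = P.ℓ := by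
        rw [Nat.card_Ioc, add_mul, one_mul, Nat.add_sub_cancel_left]

theorem card_filter_window_mem_Wadv_le {S : Finset ℕ} (hS : ∀ s ∈ S, 1 ≤ s) :
    #{s ∈ S | P.window s ∈ P.Wadv} ≤ P.Γ * P.ℓ := by
  calc #{s ∈ S | P.window s ∈ P.Wadv} ≤ P.ℓ * #P.Wadv :=
        card_le_mul_card_image_of_maps_to (fun s hs => (mem_filter.1 hs).2) P.ℓ fun j _ =>
          P.card_filter_window_eq_le (fun s hs => hS s (mem_filter.1 hs).1) j
    _ ≤ P.ℓ * P.Γ := Nat.mul_le_mul_left _ P.card_Wadv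
    _ = P.Γ * P.ℓ := mul_comm _ _

theorem n_le_card_RO_add : P.n ≤ #P.RO + P.Γ * P.ℓ := by
  have adversarial : #(Icc 1 P.n \ P.RO) ≤ P.Γ * P.ℓ :=
    (card_le_card fun s hs => mem_filter.2 ⟨(mem_sdiff.1 hs).1,
      P.adv_covered s (mem_sdiff.1 hs).1 (mem_sdiff.1 hs).2⟩).trans
      (P.card_filter_window_mem_Wadv_le fun s hs => (mem_Icc.1 hs).1)
  have split := card_sdiff_add_card_eq_card P.RO_subset
  rw [Nat.card_Icc] at split
  omega

theorem half_n_le_card_RO : (P.n : ℝ) / 2 ≤ #P.RO := by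
  have covered : (P.n : ℝ) ≤ #P.RO + P.Γ * P.ℓ := by exact_mod_cast P.n_le_card_RO_add
  linarith [(div_le_iff₀ P.n_pos).1 P.Γℓ_le]

theorem card_RO_le : #P.RO ≤ P.n := by
  simpa using card_le_card P.RO_subset

variable {P} in
theorem one_le_of_RO (s : P.RO) : 1 ≤ (s : ℕ) := (mem_Icc.1 (P.RO_subset s.2)).1

variable {P} in
theorem le_n_of_RO (s : P.RO) : (s : ℕ) ≤ P.n := (mem_Icc.1 (P.RO_subset s.2)).2

variable {P} in
theorem mul_ℓ_le_of_le_window {t : P.RO} {m : ℕ} (hm : m ≤ P.window t) : m * P.ℓ ≤ P.n := by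
  rw [← not_lt, P.window_lt_iff (one_le_of_RO t), not_le] at hm
  exact hm.le.trans (le_n_of_RO t)

/-- The free times, as a set of random-order times. -/
def free : Finset P.RO := {s | P.window s ∉ P.Wadv}

variable {P} in
theorem mem_free {s : P.RO} : s ∈ P.free ↔ P.window s ∉ P.Wadv := by
  simp [free]

theorem le_card_free_window_lt {j : ℕ} (hj : j * P.ℓ ≤ P.n) :
    j * P.ℓ ≤ #{s ∈ P.free | P.window s.1 < j} + P.Γ * P.ℓ := by
  have adversarial := P.card_filter_window_mem_Wadv_le (S := Icc 1 (j * P.ℓ))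
    fun s hs => (mem_Icc.1 hs).1
  have free_le : #{s ∈ Icc 1 (j * P.ℓ) | P.window s ∉ P.Wadv} ≤
      #{s ∈ P.free | P.window s.1 < j} := by
    rw [← card_map (Function.Embedding.subtype (· ∈ P.RO))]
    refine card_le_card fun s hs => ?_
    obtain ⟨hs, free⟩ := mem_filter.1 hs
    obtain ⟨one_le, le⟩ := mem_Icc.1 hs
    have isFree : P.IsFree s := ⟨mem_Icc.2 ⟨one_le, le.trans hj⟩, free⟩
    exact mem_map.2 ⟨⟨s, isFree.mem_RO⟩, mem_filter.2
      ⟨mem_free.2 free, (P.window_lt_iff one_le j).2 le⟩, rfl⟩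
  have split := card_filter_add_card_filter_not (s := Icc 1 (j * P.ℓ)) (P.window · ∈ P.Wadv)
  rw [Nat.card_Icc] at split
  omega

end Windows

variable {P}

section CondProb

theorem filter_arrival_nonempty (t : P.RO) (i : Fin #P.RO) :
    (univ.filter fun I : P.Arrival => I t = i).Nonempty :=
  ⟨P.RO.equivFin.trans (Equiv.swap (P.RO.equivFin t) i), by simp⟩

theorem condProb_eq_expect (E : P.Arrival → Prop) [DecidablePred E] (t : P.RO) (i : Fin #P.RO) :
    P.condProb E t i = 𝔼 I : P.Arrival with I t = i, (if E I then (1 : ℝ) else 0) := by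
  rw [expect_eq_sum_div_card, sum_boole, filter_filter, condProb]
  congr!

theorem condProb_mono {E E' : P.Arrival → Prop} {t : P.RO} {i : Fin #P.RO}
    (h : ∀ I, I t = i → E I → E' I) : P.condProb E t i ≤ P.condProb E' t i := by
  classical
  rw [condProb_eq_expect E, condProb_eq_expect E']
  refine expect_le_expect fun I hI => ?_
  by_cases hE : E I
  · rw [if_pos hE, if_pos (h I (mem_filter.1 hI).2 hE)]
  · rw [if_neg hE]
    positivity

theorem condProb_le_one (E : P.Arrival → Prop) (t : P.RO) (i : Fin #P.RO) :
    P.condProb E t i ≤ 1 := by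
  classical
  rw [condProb_eq_expect E]
  exact expect_le (filter_arrival_nonempty t i) fun I _ => by split_ifs <;> norm_num

theorem condProb_exists_le {κ : Type*} (J : Finset κ) (E : κ → P.Arrival → Prop) (t : P.RO)
    (i : Fin #P.RO) :
    P.condProb (fun I => ∃ j ∈ J, E j I) t i ≤ ∑ j ∈ J, P.condProb (E j) t i := by
  classical
  simp only [condProb_eq_expect (E _), condProb_eq_expect fun I => ∃ j ∈ J, E j I]
  rw [← expect_sum_comm]
  refine expect_le_expect fun I _ => ?_
  split_ifs with hE
  · obtain ⟨j, hj, hEj⟩ := hE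
    exact (if_pos hEj).symm.trans_le (single_le_sum (f := fun j => if E j I then (1 : ℝ) else 0)
      (fun j _ => by positivity) hj)
  · positivity

theorem condProb_or_le (E E' : P.Arrival → Prop) (t : P.RO) (i : Fin #P.RO) :
    P.condProb (fun I => E I ∨ E' I) t i ≤ P.condProb E t i + P.condProb E' t i := by
  rw [add_comm]
  simpa using condProb_exists_le univ (fun b : Bool => if b then E' else E) t i

end CondProb

section DenseSize

variable (P) in
open Classical in
/-- The size of the item `i` if it is among the densest items of total size about `b`, and `0`
otherwise. -/
noncomputable def denseSize (b : ℝ) (i : Fin #P.RO) : ℝ :=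
  if i ∈ densestItems P.v P.w b then P.w i else 0

theorem denseSize_of_mem {b : ℝ} {i : Fin #P.RO} (hi : i ∈ densestItems P.v P.w b) :
    P.denseSize b i = P.w i := if_pos hi

theorem denseSize_mem_Icc (b : ℝ) (i : Fin #P.RO) : P.denseSize b i ∈ Set.Icc (0 : ℝ) 1 := by
  rw [denseSize]
  split_ifs
  · exact ⟨(P.w_pos i).le, P.w_le_one i⟩
  · simp

theorem sum_denseSize (b : ℝ) :
    ∑ i, P.denseSize b i = ∑ i ∈ densestItems P.v P.w b, P.w i := by
  simp only [denseSize, sum_ite_mem, univ_inter]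

theorem sum_denseSize_le {b : ℝ} (hb : 0 ≤ b) : ∑ i, P.denseSize b i ≤ b + 1 :=
  (sum_denseSize b).trans_le (sum_densestItems_le (fun i => ⟨(P.w_pos i).le, P.w_le_one i⟩)
    P.density_injective hb)

theorem k_le_sum_denseSize : P.k ≤ ∑ i, P.denseSize P.k i :=
  (le_sum_densestItems (fun i => (P.w_pos i).le) P.k_le_sum_w).trans_eq (sum_denseSize P.k).symm

end DenseSize

section Mean

variable (P) in
theorem card_RO_sub_one_pos : (0 : ℝ) < #P.RO - 1 := by
  linarith [P.half_n_le_card_RO, P.le_n]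

theorem expect_erase_eq (f : Fin #P.RO → ℝ) (i : Fin #P.RO) :
    𝔼 j ∈ univ.erase i, f j = (∑ j, f j - f i) / (#P.RO - 1) := by
  rw [expect_eq_sum_div_card, card_erase_of_mem (mem_univ i), card_univ, Fintype.card_fin,
    Nat.cast_pred i.pos, sum_erase_eq_sub (mem_univ i)]

theorem card_mul_expect_erase_le {f : Fin #P.RO → ℝ} (hf : ∀ j, 0 ≤ f j) {t : P.RO}
    (i : Fin #P.RO) {S : Finset P.RO} (htS : t ∉ S) :
    #S * (𝔼 j ∈ univ.erase i, f j) ≤ (#S + 1) / #P.RO * ∑ j, f j := by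
  have card_lt : (#S : ℝ) + 1 ≤ #P.RO := by
    have h := card_le_univ (insert t S)
    rw [card_insert_of_notMem htS, Fintype.card_coe] at h
    exact_mod_cast h
  have ratio : (#S : ℝ) / (#P.RO - 1) ≤ (#S + 1) / #P.RO := by
    have pos := P.card_RO_sub_one_pos
    rw [div_le_div_iff₀ pos (by linarith)]
    linarith
  rw [expect_erase_eq, ← mul_div_assoc, ← div_mul_eq_mul_div]
  exact mul_le_mul ratio (by linarith [hf i]) (sub_nonneg.2
    (single_le_sum (fun j _ => hf j) (mem_univ i))) (by positivity)

theorem le_card_mul_expect_erase {f : Fin #P.RO → ℝ} (hf : ∀ j, f j ≤ 1) (i : Fin #P.RO)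
    (S : Finset P.RO) (hsum : 1 ≤ ∑ j, f j) :
    #S / P.n * (∑ j, f j - 1) ≤ #S * (𝔼 j ∈ univ.erase i, f j) := by
  have card_le : (#P.RO : ℝ) ≤ P.n := by exact_mod_cast P.card_RO_le
  have pos := P.card_RO_sub_one_pos
  rw [expect_erase_eq, div_mul_eq_mul_div, mul_div_assoc]
  refine mul_le_mul_of_nonneg_left ?_ (Nat.cast_nonneg _)
  exact div_le_div₀ (by linarith [hf i]) (by linarith [hf i]) pos (by linarith)

theorem mean_window_le {b : ℝ} (hb : 0 ≤ b) (hbk : b ≤ P.k) {t : P.RO} (i : Fin #P.RO)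
    {S : Finset P.RO} (htS : t ∉ S) (hS : #S ≤ P.ℓ) :
    #S * (𝔼 j ∈ univ.erase i, P.denseSize b j) ≤ 3 * P.windowBudget := by
  have n_pos := P.n_pos
  have k_ge := P.k_ge
  have half := P.half_n_le_card_RO
  have card_le : (#S : ℝ) ≤ P.ℓ := by exact_mod_cast hS
  have six_le_ℓ : (6 : ℝ) ≤ P.ℓ := by
    by_contra! h
    nlinarith [P.three_mul_n_le, P.k_le]
  calc #S * (𝔼 j ∈ univ.erase i, P.denseSize b j)
      ≤ (#S + 1) / #P.RO * ∑ j, P.denseSize b j :=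
        card_mul_expect_erase_le (fun j => (denseSize_mem_Icc b j).1) i htS
    _ ≤ (7 / 6 * P.ℓ) / (P.n / 2) * (81 / 80 * P.k) := by
        gcongr
        · exact sum_nonneg fun j _ => (denseSize_mem_Icc b j).1
        · linarith
        · exact (sum_denseSize_le hb).trans (by linarith)
    _ = 189 / 80 * P.windowBudget := by
        rw [windowBudget]
        ring
    _ ≤ 3 * P.windowBudget := by linarith [P.three_le_windowBudget]

theorem div_card_RO_le {r : ℝ} (hr : 0 ≤ r) :
    r / #P.RO ≤ r / P.n * (1 + 2 * (P.Γ * P.ℓ / P.n)) := by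
  have n_pos := P.n_pos
  have card_pos : (0 : ℝ) < #P.RO := by linarith [P.half_n_le_card_RO]
  set u : ℝ := P.Γ * P.ℓ / P.n with hu
  have u_le : u ≤ 1 / 2 := P.Γℓ_le
  have u_nonneg : 0 ≤ u := by positivity
  have le_card : P.n * (1 - u) ≤ #P.RO := by
    have covered : (P.n : ℝ) ≤ #P.RO + P.Γ * P.ℓ := by exact_mod_cast P.n_le_card_RO_add
    have : P.n * u = P.Γ * P.ℓ := by
      rw [hu]
      field_simp
    linarith
  rw [div_mul_eq_mul_div, div_le_div_iff₀ card_pos n_pos, mul_assoc]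
  refine mul_le_mul_of_nonneg_left ?_ hr
  calc (P.n : ℝ) ≤ (1 + 2 * u) * (P.n * (1 - u)) := by
        nlinarith [mul_nonneg n_pos.le (mul_nonneg u_nonneg (by linarith : 0 ≤ 1 - 2 * u))]
    _ ≤ (1 + 2 * u) * #P.RO := by gcongr

theorem mean_initial_le {b : ℝ} (hb : 0 ≤ b) (hbk : b ≤ P.k) {t : P.RO} (i : Fin #P.RO)
    {S : Finset P.RO} (htS : t ∉ S) (hS : #S + 1 ≤ (t : ℕ)) :
    #S * (𝔼 j ∈ univ.erase i, P.denseSize b j) ≤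
      t / P.n * b + 2 * (P.Γ * P.windowBudget) + 2 := by
  have n_pos := P.n_pos
  have card_le : (#S : ℝ) + 1 ≤ (t : ℕ) := by exact_mod_cast hS
  have q_le : ((t : ℕ) : ℝ) / P.n ≤ 1 := by
    rw [div_le_one n_pos]
    exact_mod_cast le_n_of_RO t
  have u_le := P.Γℓ_le
  have ΓL : (P.Γ : ℝ) * P.windowBudget = P.Γ * P.ℓ / P.n * P.k := by
    rw [windowBudget]
    ring
  rw [ΓL]
  set q : ℝ := ((t : ℕ) : ℝ) / P.n
  set u : ℝ := P.Γ * P.ℓ / P.n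
  have q_nonneg : 0 ≤ q := by positivity
  have u_nonneg : 0 ≤ u := by positivity
  calc #S * (𝔼 j ∈ univ.erase i, P.denseSize b j)
      ≤ (#S + 1) / #P.RO * ∑ j, P.denseSize b j :=
        card_mul_expect_erase_le (fun j => (denseSize_mem_Icc b j).1) i htS
    _ ≤ (q * (1 + 2 * u)) * (b + 1) := by
        refine mul_le_mul ?_ (sum_denseSize_le hb)
          (sum_nonneg fun j _ => (denseSize_mem_Icc b j).1)
          (mul_nonneg q_nonneg (by linarith [u_nonneg]))
        exact (div_le_div_of_nonneg_right card_le (Nat.cast_nonneg _)).trans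
          (div_card_RO_le (Nat.cast_nonneg _))
    _ = q * b + 2 * (q * (u * b)) + q * (1 + 2 * u) := by ring
    _ ≤ q * b + 2 * (1 * (u * P.k)) + 1 * 2 := by
        gcongr
        linarith
    _ = q * b + 2 * (u * P.k) + 2 := by ring

theorem le_mean_of_le_card {m : ℕ} (i : Fin #P.RO) {S : Finset P.RO}
    (hmn : m * P.ℓ ≤ P.n) (hS : m * P.ℓ ≤ #S + P.Γ * P.ℓ) :
    (m - P.Γ) * P.windowBudget - 1 ≤ #S * (𝔼 j ∈ univ.erase i, P.denseSize P.k j) := by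
  have n_pos := P.n_pos
  have k_ge := P.k_ge
  have sum_ge := P.k_le_sum_denseSize
  have le_card : (m - P.Γ) * (P.ℓ : ℝ) ≤ #S := by
    have : (m : ℝ) * P.ℓ ≤ #S + P.Γ * P.ℓ := by exact_mod_cast hS
    linarith
  have le_one : (m - P.Γ) * (P.ℓ : ℝ) / P.n ≤ 1 := by
    rw [div_le_one n_pos]
    have : (m : ℝ) * P.ℓ ≤ P.n := by exact_mod_cast hmn
    nlinarith [mul_nonneg (Nat.cast_nonneg (α := ℝ) P.Γ) (Nat.cast_nonneg (α := ℝ) P.ℓ)]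
  calc (m - P.Γ) * P.windowBudget - 1
      = (m - P.Γ) * (P.ℓ : ℝ) / P.n * P.k - 1 := by
        rw [windowBudget]
        ring
    _ ≤ (m - P.Γ) * (P.ℓ : ℝ) / P.n * (P.k - 1) := by linarith
    _ ≤ #S / P.n * (∑ j, P.denseSize P.k j - 1) := by
        gcongr
        linarith
    _ ≤ _ := le_card_mul_expect_erase (fun j => (denseSize_mem_Icc P.k j).2) i S (by linarith)

end Mean

section Tails

variable (P) in
theorem exp_neg_mul_log_k (m : ℕ) : Real.exp (-(m * Real.log P.k)) = 1 / P.k ^ m := by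
  rw [Real.exp_neg, Real.exp_nat_mul, Real.exp_log P.k_pos, one_div]

theorem condProb_window_le {b : ℝ} (hb : 0 ≤ b) (hbk : b ≤ P.k) {t : P.RO} (i : Fin #P.RO)
    {S : Finset P.RO} (htS : t ∉ S) (hS : #S ≤ P.ℓ) :
    P.condProb (fun I => a₁ * P.windowBudget ≤ ∑ s ∈ S, P.denseSize b (I s)) t i ≤
      1 / P.k ^ 2 := by
  rw [condProb_eq_expect]
  refine (expect_bijection_le_sum_le_exp (denseSize_mem_Icc b) i htS
    (mean_window_le hb hbk i htS hS) _).trans ?_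
  rw [← exp_neg_mul_log_k, Real.exp_le_exp, a₁]
  push_cast
  linarith [P.log_sub_half_le_windowBudget, P.four_le_log_k]

theorem condProb_initial_le {t : P.RO} (i : Fin #P.RO) {m : ℕ} (hm : 3 * P.Γ ≤ m)
    (hmt : m ≤ P.window t) :
    P.condProb (fun I => ∑ s ∈ P.free with P.window s.1 < m, P.denseSize P.k (I s) ≤
      (m + 1 - 4 * P.Γ) * P.windowBudget) t i ≤ 1 / P.k ^ 2 := by
  have k_pos := P.k_pos
  have Γ_ge := P.eight_le_Γ
  have L_ge := P.three_le_windowBudget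
  have m_ge : 3 * (P.Γ : ℝ) ≤ m := by exact_mod_cast hm
  have mℓ_le := mul_ℓ_le_of_le_window hmt
  have mean_ge := le_mean_of_le_card i mℓ_le (P.le_card_free_window_lt mℓ_le)
  have mean_le_k : (m - P.Γ) * P.windowBudget - 1 ≤ P.k := by
    nlinarith [mul_windowBudget_le_k mℓ_le]
  have gap : 2 * (P.Γ * P.windowBudget) ≤
      (m - P.Γ) * P.windowBudget - 1 - (m + 1 - 4 * P.Γ) * P.windowBudget := by nlinarith
  rw [condProb_eq_expect]
  refine (expect_bijection_sum_le_le_exp (denseSize_mem_Icc P.k) i (by simp [hmt]) mean_ge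
    (by nlinarith) mean_le_k (by nlinarith)).trans ?_
  rw [← exp_neg_mul_log_k, Real.exp_le_exp, neg_le_neg_iff, le_div_iff₀ (by positivity)]
  push_cast
  linarith [P.four_mul_log_mul_k_le, pow_le_pow_left₀ (by positivity) gap 2]

end Tails

section Selection

variable {a₄ : ℝ} {W : ℕ → ℝ} {X : ℕ → ℕ → ℝ}

theorem T_eq_zero_or_one (X : ℕ → ℕ → ℝ) (t : ℕ) : T X t = 0 ∨ T X t = 1 := by
  rw [T]
  split_ifs <;> simp

variable (P) in
theorem F_eq_zero_or_one (a₄ : ℝ) (W : ℕ → ℝ) (X : ℕ → ℕ → ℝ) (t : ℕ) :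
    P.F a₄ W X t = 0 ∨ P.F a₄ W X t = 1 := by
  rw [F]
  split_ifs <;> simp

theorem F_eq_one_iff {t : ℕ} : P.F a₄ W X t = 1 ↔
    ∑ s ∈ Ico 1 t with P.window s = P.window t, W s * P.algSel a₄ W X s ≤
      a₄ * (P.ℓ / P.n) * P.k - 1 ∧ ∑ s ∈ Ico 1 t, W s * P.algSel a₄ W X s ≤ P.k - 1 := by
  rw [F]
  split_ifs with h <;> simp [h]

variable (P) in
theorem algSel_mem_Icc (a₄ : ℝ) (W : ℕ → ℝ) (X : ℕ → ℕ → ℝ) (t : ℕ) :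
    P.algSel a₄ W X t ∈ Set.Icc (0 : ℝ) 1 := by
  rw [algSel]
  split_ifs <;> simp

theorem pos_of_algSel_ne_zero {t : ℕ} (h : P.algSel a₄ W X t ≠ 0) : 0 < X t t := by
  rw [algSel] at h
  split_ifs at h with hX
  · exact hX.1
  · exact (h rfl).elim

theorem sum_algSel_window_le (ha₄ : 0 ≤ a₄) (hW : ∀ s ∈ Icc 1 P.n, W s ≤ 1) (j : ℕ) {t : ℕ}
    (ht : t ≤ P.n + 1) :
    ∑ s ∈ Ico 1 t with P.window s = j, W s * P.algSel a₄ W X s ≤ a₄ * P.windowBudget := by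
  have budget_nonneg : 0 ≤ a₄ * P.windowBudget :=
    mul_nonneg ha₄ (by linarith [P.three_le_windowBudget])
  induction t with
  | zero => simpa using budget_nonneg
  | succ t ih =>
    rcases Nat.eq_zero_or_pos t with rfl | t_pos
    · simpa using budget_nonneg
    have ih := ih (by omega)
    rw [sum_filter] at ih ⊢
    rw [sum_Ico_succ_top t_pos]
    split_ifs with hj
    · rw [algSel_eq]
      rcases P.F_eq_zero_or_one a₄ W X t with hF | hF
      · rwa [hF, mul_zero, mul_zero, add_zero]
      · have not_full := (F_eq_one_iff.1 hF).1
        rw [hj, sum_filter, mul_windowBudget] at not_full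
        have W_le := hW t (mem_Icc.2 ⟨t_pos, by omega⟩)
        rcases T_eq_zero_or_one X t with hT | hT <;> rw [hF, hT] <;> linarith
    · rwa [add_zero]

end Selection

section LinearProgram

variable (P) in
/-- The linear program `LP_t` for values `V` and sizes `W`. -/
noncomputable def lp (V W : ℕ → ℝ) (t : ℕ) : GroupedKnapsack ℕ ℕ where
  items := Icc 1 t
  group := P.window
  size := W
  value := V
  budget := P.c t * (t / P.n) * P.k
  groupBudget _ := a₁ * (P.ℓ / P.n) * P.k

theorem c_mul_eq {t : ℕ} (ht : 1 ≤ t) :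
    P.c t * (t / P.n) * P.k = t / P.n * P.k - 4 * (P.Γ * P.windowBudget) := by
  rw [c, windowBudget]
  field_simp

theorem lpFeasible_zero (W : ℕ → ℝ) {t : ℕ} (ht : 1 ≤ t) (hΓ : 4 * P.Γ * P.ℓ ≤ t) :
    P.LPFeasible W t 0 := by
  have t_pos : (0 : ℝ) < t := by exact_mod_cast ht
  have c_nonneg : 0 ≤ P.c t := by
    rw [c, sub_nonneg, div_le_one t_pos]
    exact_mod_cast hΓ
  have k_pos := P.k_pos
  refine ⟨by simp, ?_, fun j => ?_⟩ <;>
    simp only [Pi.zero_apply, mul_zero, sum_const_zero]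
  · positivity
  · rw [mul_windowBudget, a₁]
    linarith [P.three_le_windowBudget]

variable {A : P.Adversary} {X : P.Arrival → ℕ → ℕ → ℝ}

theorem IsLPChoice.isOptimal (hX : P.IsLPChoice A X) {t : ℕ} (ht : t ∈ Icc 1 P.n)
    (hΓ : 4 * P.Γ * P.ℓ ≤ t) (I : P.Arrival) :
    (P.lp (A.V I) (A.W I) t).IsOptimal (X I t) :=
  hX I t ht ⟨0, lpFeasible_zero _ (mem_Icc.1 ht).1 hΓ⟩

theorem four_mul_Γ_mul_ℓ_le {t : P.RO} (hΓ : 4 * P.Γ ≤ P.window t) : 4 * P.Γ * P.ℓ ≤ t := by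
  rw [← not_lt, P.window_lt_iff (one_le_of_RO t), not_le] at hΓ
  exact hΓ.le

theorem isFree_of_lt {t : P.RO} {u : ℕ} (hu : u ∈ Ico 1 (t : ℕ)) (hw : P.window u ∉ P.Wadv) :
    P.IsFree u :=
  ⟨mem_Icc.2 ⟨(mem_Ico.1 hu).1, (mem_Ico.1 hu).2.le.trans (le_n_of_RO t)⟩, hw⟩

theorem sum_le_sum_denseSize {D : Finset ℕ} {S : Finset P.RO} {y : ℕ → ℝ} {b : ℝ} {I : P.Arrival}
    (hD : ∀ u ∈ D, u ∈ P.RO) (h : ∀ u : P.RO, (u : ℕ) ∈ D → u ∈ S ∧ y u ≤ P.denseSize b (I u)) :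
    ∑ u ∈ D, y u ≤ ∑ s ∈ S, P.denseSize b (I s) := by
  rw [← sum_subtype_of_mem y hD]
  refine (sum_le_sum fun u hu => (h u (mem_subtype.1 hu)).2).trans ?_
  exact sum_le_sum_of_subset_of_nonneg (fun u hu => (h u (mem_subtype.1 hu)).1)
    fun u _ _ => (denseSize_mem_Icc b _).1

end LinearProgram

section Typical

/-- The arrival orders that behave typically up to the window of `t`, where typical means that no
window receives too many, and no initial segment of windows too few, of the items that are among
the densest of total size `k`. -/
structure IsTypical (t : P.RO) (I : P.Arrival) : Prop where
  window_le : ∀ j ≤ P.window t,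
    ∑ s ∈ P.free.erase t with P.window s.1 = j, P.denseSize P.k (I s) ≤ a₁ * P.windowBudget
  lt_initial : ∀ j ≤ P.window t, 3 * P.Γ ≤ j →
    (j + 1 - 4 * P.Γ) * P.windowBudget <
      ∑ s ∈ P.free with P.window s.1 < j, P.denseSize P.k (I s)

theorem card_erase_filter_window_le (t : P.RO) (j : ℕ) :
    #{s ∈ P.free.erase t | P.window s.1 = j} ≤ P.ℓ := by
  rw [← card_map (Function.Embedding.subtype (· ∈ P.RO))]
  refine (card_le_card fun s hs => ?_).trans
    (P.card_filter_window_eq_le (fun s hs => (mem_Icc.1 (P.RO_subset hs)).1) j)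
  obtain ⟨u, hu, rfl⟩ := mem_map.1 hs
  exact mem_filter.2 ⟨u.2, (mem_filter.1 hu).2⟩

theorem condProb_not_isTypical_le (t : P.RO) (i : Fin #P.RO) :
    P.condProb (fun I => ¬P.IsTypical t I) t i ≤ 2 / P.k := by
  have k_pos := P.k_pos
  have k_ge := P.k_ge
  have card_le : ((P.window t + 1 : ℕ) : ℝ) ≤ P.k := by
    push_cast
    nlinarith [P.three_le_windowBudget, mul_windowBudget_le_k (mul_ℓ_le_of_le_window le_rfl :
      P.window t * P.ℓ ≤ P.n), Nat.cast_nonneg (α := ℝ) (P.window t)]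
  have sum_le (J : Finset ℕ) (hJ : J ⊆ range (P.window t + 1)) (E : ℕ → P.Arrival → Prop)
      (hE : ∀ j ∈ J, P.condProb (E j) t i ≤ 1 / P.k ^ 2) :
      P.condProb (fun I => ∃ j ∈ J, E j I) t i ≤ 1 / P.k := by
    have card_J : (#J : ℝ) ≤ P.k :=
      (Nat.cast_le.2 ((card_le_card hJ).trans_eq (card_range _))).trans card_le
    calc P.condProb (fun I => ∃ j ∈ J, E j I) t i
        ≤ ∑ j ∈ J, P.condProb (E j) t i := condProb_exists_le J E t i
      _ ≤ #J • (1 / P.k ^ 2) := sum_le_card_nsmul J _ _ hE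
      _ ≤ P.k * (1 / P.k ^ 2) := by
        rw [nsmul_eq_mul]
        gcongr
      _ = 1 / P.k := by field_simp
  have full := sum_le (range (P.window t + 1)) Subset.rfl (fun j I => a₁ * P.windowBudget ≤
    ∑ s ∈ P.free.erase t with P.window s.1 = j, P.denseSize P.k (I s)) fun j _ =>
      condProb_window_le k_pos.le le_rfl i (by simp) (card_erase_filter_window_le t j)
  have sparse := sum_le {j ∈ range (P.window t + 1) | 3 * P.Γ ≤ j} (filter_subset _ _)
    (fun j I => ∑ s ∈ P.free with P.window s.1 < j, P.denseSize P.k (I s) ≤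
      (j + 1 - 4 * P.Γ) * P.windowBudget) fun j hj => by
        obtain ⟨hj, hΓ⟩ := mem_filter.1 hj
        exact condProb_initial_le i hΓ (Nat.lt_succ_iff.1 (mem_range.1 hj))
  calc P.condProb (fun I => ¬P.IsTypical t I) t i
      ≤ _ := condProb_mono fun I _ not_typical => by
        contrapose! not_typical
        exact ⟨fun j hj => (not_typical.1 j (mem_range.2 (by omega))).le,
          fun j hj hΓ => not_typical.2 j (mem_filter.2 ⟨mem_range.2 (by omega), hΓ⟩)⟩
    _ ≤ 1 / P.k + 1 / P.k := (condProb_or_le _ _ t i).trans (add_le_add full sparse)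
    _ = 2 / P.k := by ring

end Typical

section OnlyDenseSelected

variable {A : P.Adversary} {X : P.Arrival → ℕ → ℕ → ℝ} {t s : P.RO} {I : P.Arrival}

theorem budget_le_of_window (s : P.RO) :
    P.c s * (s / P.n) * P.k ≤ (P.window s + 1 - 4 * P.Γ) * P.windowBudget := by
  have k_pos := P.k_pos
  have s_le : ((s : ℕ) : ℝ) ≤ (P.window s + 1) * P.ℓ := by
    exact_mod_cast (P.window_lt_iff (one_le_of_RO s) _).1 (Nat.lt_succ_self _)
  rw [c_mul_eq (one_le_of_RO s)]
  calc ((s : ℕ) : ℝ) / P.n * P.k - 4 * (P.Γ * P.windowBudget)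
      ≤ (P.window s + 1) * P.ℓ / P.n * P.k - 4 * (P.Γ * P.windowBudget) := by gcongr
    _ = _ := by
      rw [windowBudget]
      ring

variable (P) in
theorem window_mono : Monotone P.window := fun _ _ h =>
  Nat.div_le_div_right (Nat.sub_le_sub_right h 1)

theorem IsLPChoice.sum_denser_le (hX : P.IsLPChoice A X) (hΓ : 4 * P.Γ ≤ P.window s)
    (hpos : 0 < X I s s) {D : Finset P.RO} (hD : ∀ u ∈ D, u ≤ s)
    (denser : ∀ u ∈ D, P.v (I s) / P.w (I s) < P.v (I u) / P.w (I u))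
    (hgroup : ∀ j, ∑ u ∈ D with P.window u.1 = j, P.w (I u) ≤ a₁ * P.windowBudget) :
    ∑ u ∈ D, P.w (I u) ≤ P.c s * (s / P.n) * P.k := by
  have sum_W (S : Finset P.RO) :
      ∑ u ∈ S.map (Function.Embedding.subtype _), A.W I u = ∑ u ∈ S, P.w (I u) :=
    (sum_map S _ _).trans (sum_congr rfl fun u _ => A.W_RO I u)
  rw [← sum_W]
  refine (hX.isOptimal (P.RO_subset s.2) (four_mul_Γ_mul_ℓ_le hΓ) I).sum_size_denser_le
    (fun u hu => (A.W_mem I u (Icc_subset_Icc_right (le_n_of_RO s) hu)).1)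
    (mem_Icc.2 ⟨one_le_of_RO s, le_rfl⟩) hpos (fun _ mem => ?_) (fun _ mem => ?_) fun j => ?_
  · obtain ⟨u, hu, rfl⟩ := mem_map.1 mem
    exact mem_Icc.2 ⟨one_le_of_RO u, hD u hu⟩
  · obtain ⟨u, hu, rfl⟩ := mem_map.1 mem
    simpa only [lp, Function.Embedding.subtype_apply, A.V_RO, A.W_RO] using
      (div_lt_div_iff₀ (P.w_pos _) (P.w_pos _)).1 (denser u hu)
  · have group_le : ∑ u ∈ D.map (Function.Embedding.subtype _) with P.window u = j, A.W I u ≤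
        a₁ * (P.ℓ / P.n) * P.k := by
      rw [filter_map, sum_W, mul_windowBudget]
      exact hgroup j
    exact group_le

theorem IsTypical.mem_densestItems (typical : P.IsTypical t I) (hX : P.IsLPChoice A X)
    (hst : s ≤ t) (hΓ : 4 * P.Γ ≤ P.window s) (hpos : 0 < X I s s) :
    I s ∈ densestItems P.v P.w P.k := by
  by_contra not_dense
  have window_le : P.window s ≤ P.window t := P.window_mono hst
  set D : Finset P.RO :=
    {u ∈ P.free | P.window u.1 < P.window s ∧ I u ∈ densestItems P.v P.w P.k} with D_def
  have mem_D {u : P.RO} : u ∈ D ↔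
      u ∈ P.free ∧ P.window u.1 < P.window s ∧ I u ∈ densestItems P.v P.w P.k := mem_filter
  have D_le : ∑ u ∈ D, P.w (I u) ≤ P.c s * (s / P.n) * P.k := by
    refine hX.sum_denser_le hΓ hpos
      (fun u hu => P.window_mono.reflect_lt (mem_D.1 hu).2.1 |>.le)
      (fun u hu => lt_of_not_ge fun h => not_dense
        (mem_densestItems_of_le (fun i => (P.w_pos i).le) (mem_D.1 hu).2.2 h)) fun j => ?_
    rcases le_or_gt j (P.window t) with hj | hj
    · refine le_trans ?_ (typical.window_le j hj)
      calc ∑ u ∈ D with P.window u.1 = j, P.w (I u)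
          = ∑ u ∈ D with P.window u.1 = j, P.denseSize P.k (I u) :=
            sum_congr rfl fun u hu => (denseSize_of_mem (mem_D.1 (mem_filter.1 hu).1).2.2).symm
        _ ≤ ∑ u ∈ P.free.erase t with P.window u.1 = j, P.denseSize P.k (I u) := by
            refine sum_le_sum_of_subset_of_nonneg (filter_subset_filter _ fun u hu => ?_)
              fun u _ _ => (denseSize_mem_Icc _ _).1
            exact mem_erase.2 ⟨by rintro rfl; exact (mem_D.1 hu).2.1.not_ge window_le,
              (mem_D.1 hu).1⟩
    · rw [filter_eq_empty_iff.2 fun u hu => (((mem_D.1 hu).2.1.trans_le window_le).trans hj).ne,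
        sum_empty, a₁]
      linarith [P.three_le_windowBudget]
  have D_gt : (P.window s + 1 - 4 * P.Γ) * P.windowBudget < ∑ u ∈ D, P.w (I u) := by
    refine (typical.lt_initial _ window_le (by omega)).trans_eq ?_
    simp only [D_def, denseSize, ← filter_filter, sum_filter]
  exact (D_gt.trans_le D_le).not_ge (budget_le_of_window s)

theorem IsTypical.W_mul_algSel_le (typical : P.IsTypical t I) (hX : P.IsLPChoice A X)
    (hst : s ≤ t) (hΓ : 4 * P.Γ ≤ P.window s) (a₄ : ℝ) :
    A.W I s * P.algSel a₄ (A.W I) (X I) s ≤ P.denseSize P.k (I s) := by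
  by_cases selected : P.algSel a₄ (A.W I) (X I) s = 0
  · rw [selected, mul_zero]
    exact (denseSize_mem_Icc _ _).1
  · rw [denseSize_of_mem (typical.mem_densestItems hX hst hΓ (pos_of_algSel_ne_zero selected)),
      A.W_RO]
    exact mul_le_of_le_one_right (P.w_pos _).le (P.algSel_mem_Icc _ _ _ _).2

end OnlyDenseSelected

section Blocking

variable {A : P.Adversary} {X : P.Arrival → ℕ → ℕ → ℝ} {t : P.RO} {I : P.Arrival} {a₄ : ℝ}

theorem IsTypical.sum_algSel_window_le (typical : P.IsTypical t I) (hX : P.IsLPChoice A X)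
    (ht : t ∈ P.free) (hΓ : 4 * P.Γ ≤ P.window t) :
    ∑ s ∈ Ico 1 (t : ℕ) with P.window s = P.window t, A.W I s * P.algSel a₄ (A.W I) (X I) s ≤
      a₁ * P.windowBudget := by
  refine (sum_le_sum_denseSize (fun u hu => ?_) fun u hu => ?_).trans
    (typical.window_le _ le_rfl)
  · obtain ⟨hu, hw⟩ := mem_filter.1 hu
    exact (isFree_of_lt hu (hw ▸ mem_free.1 ht)).mem_RO
  · obtain ⟨hu, hw⟩ := mem_filter.1 hu
    have hut : u < t := (mem_Ico.1 hu).2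
    refine ⟨mem_filter.2 ⟨mem_erase.2 ⟨hut.ne, mem_free.2 (hw ▸ mem_free.1 ht)⟩, hw⟩,
      typical.W_mul_algSel_le hX hut.le (hw ▸ hΓ) a₄⟩

theorem IsTypical.lt_sum_denseSize_of_F_eq_zero (typical : P.IsTypical t I)
    (hX : P.IsLPChoice A X) (ha₄ : 602 ≤ a₄) (ht : t ∈ P.free) (hΓ : 4 * P.Γ ≤ P.window t)
    (hF : P.F a₄ (A.W I) (X I) t = 0) :
    P.k - 1 - 5 * P.Γ * (a₄ * P.windowBudget) <
      ∑ s ∈ P.free with s < t, P.denseSize P.k (I s) := by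
  have L_ge := P.three_le_windowBudget
  have window_not_full := typical.sum_algSel_window_le (a₄ := a₄) hX ht hΓ
  have knapsack_full :
      P.k - 1 < ∑ s ∈ Ico 1 (t : ℕ), A.W I s * P.algSel a₄ (A.W I) (X I) s := by
    by_contra! not_full
    refine zero_ne_one (hF.symm.trans (F_eq_one_iff.2 ⟨?_, not_full⟩))
    rw [mul_windowBudget]
    rw [a₁] at window_not_full
    nlinarith
  have card_le : (#(P.Wadv ∪ range (4 * P.Γ)) : ℝ) ≤ 5 * P.Γ := by
    have h := card_union_le P.Wadv (range (4 * P.Γ))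
    rw [card_range] at h
    exact_mod_cast h.trans (by linarith [P.card_Wadv])
  have outside : ∑ s ∈ Ico 1 (t : ℕ) with P.window s ∉ P.Wadv ∪ range (4 * P.Γ),
      A.W I s * P.algSel a₄ (A.W I) (X I) s ≤ ∑ s ∈ P.free with s < t, P.denseSize P.k (I s) := by
    refine sum_le_sum_denseSize (fun u hu => ?_) fun u hu => ?_ <;>
      obtain ⟨hu, hw⟩ := mem_filter.1 hu <;>
      simp only [mem_union, mem_range, not_or, not_lt] at hw
    · exact (isFree_of_lt hu hw.1).mem_RO
    · have hut : u < t := (mem_Ico.1 hu).2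
      exact ⟨mem_filter.2 ⟨mem_free.2 hw.1, hut⟩, typical.W_mul_algSel_le hX hut.le hw.2 a₄⟩
  have split := sum_le_sum_add_sum_filter_notMem (P.Wadv ∪ range (4 * P.Γ)) fun j _ =>
    P.sum_algSel_window_le (a₄ := a₄) (X := X I) (by linarith) (fun s hs => (A.W_mem I s hs).2) j
      ((le_n_of_RO t).trans (Nat.le_succ _))
  rw [sum_const, nsmul_eq_mul] at split
  have : (#(P.Wadv ∪ range (4 * P.Γ)) : ℝ) * (a₄ * P.windowBudget) ≤
      5 * P.Γ * (a₄ * P.windowBudget) := by gcongr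
  linarith

theorem card_free_lt_add_one_le (t : P.RO) : #{s ∈ P.free | s < t} + 1 ≤ (t : ℕ) := by
  have card_le : #{s ∈ P.free | s < t} ≤ #(Ico 1 (t : ℕ)) := by
    rw [← card_map (Function.Embedding.subtype (· ∈ P.RO))]
    refine card_le_card fun s hs => ?_
    obtain ⟨u, hu, rfl⟩ := mem_map.1 hs
    exact mem_Ico.2 ⟨one_le_of_RO u, (mem_filter.1 hu).2⟩
  rw [Nat.card_Ico] at card_le
  have := one_le_of_RO t
  omega

theorem condProb_le_sum_denseSize_le {δ : ℝ} (hδ : 0 ≤ δ) (hδ' : δ ≤ 1) (i : Fin #P.RO)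
    (hM : t / P.n * P.k + 2 * (P.Γ * P.windowBudget) + 2 ≤ P.k) :
    P.condProb (fun I => t / P.n * P.k + 2 * (P.Γ * P.windowBudget) + 2 + P.k * δ ≤
      ∑ s ∈ P.free with s < t, P.denseSize P.k (I s)) t i ≤ Real.exp (-(P.k * δ ^ 2 / 4)) := by
  classical
  have k_pos := P.k_pos
  rw [condProb_eq_expect]
  refine (expect_bijection_add_le_sum_le_exp (denseSize_mem_Icc P.k) i (by simp)
    (mean_initial_le k_pos.le le_rfl i (by simp) (card_free_lt_add_one_le t)) hM
    (by positivity) (by nlinarith)).trans_eq ?_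
  congr 2
  field_simp

theorem condProb_blocked_le_of_slack (hX : P.IsLPChoice A X) (ha₄ : 602 ≤ a₄) (ht : t ∈ P.free)
    (hΓ : 4 * P.Γ ≤ P.window t) (i : Fin #P.RO) {δ : ℝ} (hδ : 0 < δ)
    (slack : t / P.n * P.k + 2 * (P.Γ * P.windowBudget) + 2 + P.k * δ ≤
      P.k - 1 - 5 * P.Γ * (a₄ * P.windowBudget)) :
    P.condProb (fun I => P.F a₄ (A.W I) (X I) t = 0) t i ≤ 6 / (P.k * δ ^ 2) := by
  have k_pos := P.k_pos
  have L_ge := P.three_le_windowBudget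
  have ΓL_nonneg : 0 ≤ P.Γ * P.windowBudget := by positivity
  have Γa₄L_nonneg : 0 ≤ P.Γ * (a₄ * P.windowBudget) := by positivity
  have t_nonneg : 0 ≤ ((t : ℕ) : ℝ) / P.n * P.k := by positivity
  have δ_le_one : δ ≤ 1 := by
    by_contra! h
    nlinarith
  have exp_le : Real.exp (-(P.k * δ ^ 2 / 4)) ≤ 4 / (P.k * δ ^ 2) := by
    rw [Real.exp_neg, ← inv_div _ 4]
    gcongr
    linarith [Real.add_one_le_exp (P.k * δ ^ 2 / 4)]
  have two_div_le : 2 / P.k ≤ 2 / (P.k * δ ^ 2) :=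
    div_le_div_of_nonneg_left (by norm_num) (by positivity)
      (mul_le_of_le_one_right k_pos.le (pow_le_one₀ hδ.le δ_le_one))
  calc P.condProb (fun I => P.F a₄ (A.W I) (X I) t = 0) t i
      ≤ P.condProb (fun I => ¬P.IsTypical t I ∨
          t / P.n * P.k + 2 * (P.Γ * P.windowBudget) + 2 + P.k * δ ≤
            ∑ s ∈ P.free with s < t, P.denseSize P.k (I s)) t i :=
        condProb_mono fun I _ hF => or_iff_not_imp_left.2 fun typical => slack.trans
          ((not_not.1 typical).lt_sum_denseSize_of_F_eq_zero hX ha₄ ht hΓ hF).le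
    _ ≤ 2 / P.k + Real.exp (-(P.k * δ ^ 2 / 4)) :=
        (condProb_or_le _ _ t i).trans (add_le_add (condProb_not_isTypical_le t i)
          (condProb_le_sum_denseSize_le hδ.le δ_le_one i (by nlinarith)))
    _ ≤ 2 / (P.k * δ ^ 2) + 4 / (P.k * δ ^ 2) := add_le_add two_div_le exp_le
    _ = 6 / (P.k * δ ^ 2) := by ring

theorem condProb_blocked_le (hX : P.IsLPChoice A X) (ha₄ : 602 ≤ a₄) (ht : t ∈ P.free)
    (hΓ : 4 * P.Γ ≤ P.window t) (i : Fin #P.RO) :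
    P.condProb (fun I => P.F a₄ (A.W I) (X I) t = 0) t i ≤ P.p 6 (6 * a₄ + 4) t := by
  rw [p]
  split_ifs with hδ
  · refine condProb_blocked_le_of_slack hX ha₄ ht hΓ i hδ ?_
    have k_pos := P.k_pos
    have Γ_ge := P.eight_le_Γ
    have log_ge := P.four_le_log_k
    have ΓL_le : P.Γ * P.windowBudget ≤ 9 / 8 * (P.Γ * Real.log P.k) := by
      nlinarith [P.windowBudget_le_log_add_half]
    have Γlog_ge : 32 ≤ P.Γ * Real.log P.k := by nlinarith
    have expand : P.k * (1 - t / P.n - (6 * a₄ + 4) * (P.Γ * Real.log P.k / P.k)) =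
        P.k - t / P.n * P.k - (6 * a₄ + 4) * (P.Γ * Real.log P.k) := by field_simp
    rw [expand]
    nlinarith [mul_le_mul_of_nonneg_left ΓL_le (by linarith : 0 ≤ a₄)]
  · exact condProb_le_one _ t i

end Blocking

section NotSelected

variable {A : P.Adversary} {X : P.Arrival → ℕ → ℕ → ℝ} {t : P.RO} {I : P.Arrival} {b : ℝ}

theorem lt_and_W_eq_of_mem_rivals (hI : I t ∈ densestItems P.v P.w b) {u : P.RO}
    (hu : (u : ℕ) ∈ (P.lp (A.V I) (A.W I) t).rivals t) :
    u < t ∧ A.W I u = P.denseSize b (I u) := by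
  obtain ⟨hu, dense⟩ := mem_filter.1 hu
  obtain ⟨hut, hu⟩ := mem_erase.1 hu
  simp only [lp, A.V_RO, A.W_RO] at hu dense
  refine ⟨lt_of_le_of_ne (mem_Icc.1 hu).2 fun h => hut (congrArg Subtype.val h), ?_⟩
  rw [A.W_RO, denseSize_of_mem (mem_densestItems_of_le (fun i => (P.w_pos i).le) hI
    ((div_le_div_iff₀ (P.w_pos _) (P.w_pos _)).2 dense))]

theorem sum_W_rivals_le {q : ℕ → Prop} [DecidablePred q] (hI : I t ∈ densestItems P.v P.w b)
    (hq : ∀ u, q u → P.window u ∉ P.Wadv) :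
    ∑ u ∈ (P.lp (A.V I) (A.W I) t).rivals t with q u, A.W I u ≤
      ∑ s ∈ P.free with s < t ∧ q s.1, P.denseSize b (I s) := by
  refine sum_le_sum_denseSize (fun u hu => ?_) fun u hu => ?_ <;>
    obtain ⟨hu, hqu⟩ := mem_filter.1 hu
  · obtain ⟨hut, hu⟩ := mem_erase.1 (mem_of_mem_filter u hu)
    obtain ⟨one_le, le⟩ := mem_Icc.1 hu
    exact (isFree_of_lt (mem_Ico.2 ⟨one_le, le.lt_of_ne hut⟩) (hq u hqu)).mem_RO
  · obtain ⟨hut, W_eq⟩ := lt_and_W_eq_of_mem_rivals hI hu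
    exact ⟨mem_filter.2 ⟨mem_free.2 (hq u hqu), hut, hqu⟩, W_eq.le⟩

theorem IsLPChoice.le_sum_denseSize_of_T_eq_zero (hX : P.IsLPChoice A X) (ht : t ∈ P.free)
    (hΓ : 4 * P.Γ * P.ℓ ≤ t) (hT : T (X I) t = 0) (hI : I t ∈ densestItems P.v P.w b) :
    a₁ * P.windowBudget ≤
        ∑ s ∈ P.free with s < t ∧ P.window s.1 = P.window t, P.denseSize b (I s) ∨
      t / P.n * P.k - (a₁ + 4) * (P.Γ * P.windowBudget) ≤
        ∑ s ∈ P.free with s < t, P.denseSize b (I s) := by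
  have optimal := hX.isOptimal (P.RO_subset t.2) hΓ I
  have t_mem : (t : ℕ) ∈ (P.lp (A.V I) (A.W I) t).items := mem_Icc.2 ⟨one_le_of_RO t, le_rfl⟩
  have not_selected : X I t t = 0 := by
    rw [T] at hT
    split_ifs at hT with hpos
    · exact (one_ne_zero hT).elim
    · exact le_antisymm (not_lt.1 hpos) (optimal.1.1 t t_mem).1
  have V_pos : 0 < A.V I t := (A.V_RO I t).symm ▸ P.v_pos _
  refine (optimal.le_sum_rivals (fun u hu =>
    (A.W_mem I u (Icc_subset_Icc_right (le_n_of_RO t) hu)).1) t_mem V_pos not_selected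
    P.Wadv).imp (fun window_full => ?_) fun budget_full => ?_
  · rw [← mul_windowBudget]
    exact window_full.trans (sum_W_rivals_le (q := (P.window · = P.window t)) hI
      fun u hu => hu ▸ mem_free.1 ht)
  · have adversarial_le : ∑ _ ∈ P.Wadv, a₁ * (P.ℓ / P.n) * P.k ≤
        a₁ * (P.Γ * P.windowBudget) := by
      have card_le : (#P.Wadv : ℝ) ≤ P.Γ := by exact_mod_cast P.card_Wadv
      rw [sum_const, nsmul_eq_mul, mul_windowBudget, mul_left_comm, a₁]
      gcongr
      linarith [P.three_le_windowBudget]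
    calc t / P.n * P.k - (a₁ + 4) * (P.Γ * P.windowBudget)
        ≤ P.c t * (t / P.n) * P.k - ∑ _ ∈ P.Wadv, a₁ * (P.ℓ / P.n) * P.k := by
          rw [c_mul_eq (one_le_of_RO t)]
          linarith
      _ ≤ ∑ s ∈ P.free with s < t ∧ P.window s.1 ∉ P.Wadv, P.denseSize b (I s) :=
          budget_full.trans (sum_W_rivals_le (q := (P.window · ∉ P.Wadv)) hI fun u hu => hu)
      _ ≤ ∑ s ∈ P.free with s < t, P.denseSize b (I s) :=
          sum_le_sum_of_subset_of_nonneg (monotone_filter_right _ fun _ _ h => h.1)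
            fun _ _ _ => (denseSize_mem_Icc b _).1

end NotSelected

section ErrorTerm

variable (P) in
theorem ε_nonneg (t : ℕ) : 0 ≤ P.ε t := by
  rw [ε, a₁]
  positivity

variable (P) in
theorem c_le_one (t : ℕ) : P.c t ≤ 1 := by
  rw [c, sub_le_self_iff]
  positivity

theorem lt_of_c_pos {t : ℕ} (ht : 1 ≤ t) (hc : 0 < P.c t) : 4 * P.Γ * P.ℓ < t := by
  have t_pos : (0 : ℝ) < t := by exact_mod_cast ht
  rw [c, sub_pos, div_lt_one t_pos] at hc
  exact_mod_cast hc

theorem mul_c_sub_ε {t : ℕ} (ht : 1 ≤ t) :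
    t / P.n * ((P.c t - P.ε t) * P.k) = t / P.n * P.k - (a₁ + 7) * (P.Γ * P.windowBudget) -
      √(20 * Real.log P.k * (t / P.n * P.k)) := by
  have t_pos : (0 : ℝ) < t := by exact_mod_cast ht
  have n_pos := P.n_pos
  have k_pos := P.k_pos
  have log_ge := P.four_le_log_k
  have sqrt_mul : √(10 * Real.log P.k) * √(2 * P.n / (t * P.k)) * (t / P.n * P.k) =
      √(20 * Real.log P.k * (t / P.n * P.k)) := by
    have K_pos : 0 < (t : ℝ) / P.n * P.k := mul_pos (div_pos t_pos n_pos) k_pos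
    nth_rw 1 [← Real.sqrt_sq K_pos.le]
    rw [← Real.sqrt_mul (by positivity), ← Real.sqrt_mul (by positivity)]
    congr 1
    field_simp
    ring
  rw [← sqrt_mul, c, ε, windowBudget]
  field_simp
  ring

end ErrorTerm

section SelectionProbability

variable {A : P.Adversary} {X : P.Arrival → ℕ → ℕ → ℝ} {t : P.RO}

theorem condProb_le_sum_denseSize_c_sub_ε_le (hγ : 0 < P.c t - P.ε t) (i : Fin #P.RO) :
    P.condProb (fun I => t / P.n * P.k - (a₁ + 4) * (P.Γ * P.windowBudget) ≤
      ∑ s ∈ P.free with s < t, P.denseSize ((P.c t - P.ε t) * P.k) (I s)) t i ≤ 1 / P.k := by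
  classical
  have k_pos := P.k_pos
  have n_pos := P.n_pos
  have t_pos : (0 : ℝ) < (t : ℕ) := by exact_mod_cast one_le_of_RO t
  have log_ge := P.four_le_log_k
  have ΓL_ge : 24 ≤ P.Γ * P.windowBudget := by nlinarith [P.eight_le_Γ, P.three_le_windowBudget]
  have γ_le : P.c t - P.ε t ≤ 1 := by linarith [P.c_le_one t, P.ε_nonneg t]
  have γK_pos : 0 < t / P.n * ((P.c t - P.ε t) * P.k) := by positivity
  have mean_le := mean_initial_le (mul_pos hγ k_pos).le (mul_le_of_le_one_left k_pos.le γ_le) i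
    (S := {s ∈ P.free | s < t}) (by simp) (card_free_lt_add_one_le t)
  rw [mul_c_sub_ε (one_le_of_RO t), a₁] at γK_pos mean_le
  set K : ℝ := t / P.n * P.k
  have K_pos : 0 < K := by positivity
  set D : ℝ := √(20 * Real.log P.k * K)
  have D_nonneg : 0 ≤ D := Real.sqrt_nonneg _
  have D_sq : D ^ 2 / (4 * K) = (5 : ℕ) * Real.log P.k := by
    rw [Real.sq_sqrt (by positivity)]
    field_simp
    norm_num
  have tail := expect_bijection_add_le_sum_le_exp (S := {s ∈ P.free | s < t}) (t := t) (K := K)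
    (D := D) (denseSize_mem_Icc _) i (by simp) mean_le (by linarith) D_nonneg (by linarith)
  rw [D_sq, exp_neg_mul_log_k] at tail
  refine (condProb_mono (E' := fun I => _ ≤ _) fun I _ h => le_trans ?_ h).trans
    ((condProb_eq_expect _ t i).trans_le (tail.trans ?_))
  · rw [a₁]
    linarith
  · exact one_div_le_one_div_of_le k_pos (le_self_pow₀ (by linarith [P.k_ge]) (by norm_num))

theorem condProb_not_selected_le (hX : P.IsLPChoice A X) (ht : t ∈ P.free)
    (hγ : 0 < P.c t - P.ε t) {i : Fin #P.RO}
    (hi : i ∈ densestItems P.v P.w ((P.c t - P.ε t) * P.k)) :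
    P.condProb (fun I => T (X I) t = 0) t i ≤ 2 / P.k := by
  have k_pos := P.k_pos
  have γ_le : P.c t - P.ε t ≤ 1 := by linarith [P.c_le_one t, P.ε_nonneg t]
  have hΓ := lt_of_c_pos (one_le_of_RO t) (by linarith [P.ε_nonneg t])
  have card_le : #{s ∈ P.free | s < t ∧ P.window s.1 = P.window t} ≤ P.ℓ := by
    refine (card_le_card fun s hs => ?_).trans (card_erase_filter_window_le t (P.window t))
    obtain ⟨free, hst, same⟩ := mem_filter.1 hs
    exact mem_filter.2 ⟨mem_erase.2 ⟨hst.ne, free⟩, same⟩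
  have window_tail := condProb_window_le (mul_pos hγ k_pos).le
    (mul_le_of_le_one_left k_pos.le γ_le) (t := t) i (by simp) card_le
  calc P.condProb (fun I => T (X I) t = 0) t i
      ≤ _ := condProb_mono fun I hI hT => hX.le_sum_denseSize_of_T_eq_zero ht hΓ.le hT (hI ▸ hi)
    _ ≤ 1 / P.k ^ 2 + 1 / P.k := (condProb_or_le _ _ t i).trans
        (add_le_add window_tail (condProb_le_sum_denseSize_c_sub_ε_le hγ i))
    _ ≤ 1 / P.k + 1 / P.k := by
        gcongr
        exact le_self_pow₀ (by linarith [P.k_ge]) (by norm_num)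
    _ = 2 / P.k := by ring

end SelectionProbability

section CollectedValue

theorem mul_OPT_le {γ : ℝ} (hγ : 0 < γ) (hγ' : γ ≤ 1) :
    γ * P.OPT ≤ ∑ i ∈ densestItems P.v P.w (γ * P.k), P.v i := by
  rw [mul_comm, ← le_div_iff₀ hγ]
  refine Real.sSup_le ?_ (div_nonneg (sum_nonneg fun i _ => (P.v_pos i).le) hγ.le)
  rintro _ ⟨x, hx, size_le, rfl⟩
  rw [le_div_iff₀' hγ, mul_sum]
  have size_smul_le : ∑ i, P.w i * (γ * x i) ≤ γ * P.k := by
    simp only [mul_left_comm, ← mul_sum]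
    gcongr
  have γk_le : γ * P.k ≤ ∑ i, P.w i :=
    (mul_le_of_le_one_left P.k_pos.le hγ').trans P.k_le_sum_w
  simpa only [mul_left_comm γ] using sum_mul_le_sum_densestItems (fun i => (P.v_pos i).le) P.w_pos
    (fun i => ⟨mul_nonneg hγ.le (hx i).1, mul_le_one₀ hγ' (hx i).1 (hx i).2⟩) size_smul_le γk_le

variable (P) in
theorem OPT_nonneg : 0 ≤ P.OPT := by
  refine Real.sSup_nonneg ?_
  rintro _ ⟨x, hx, -, rfl⟩
  exact sum_nonneg fun i _ => mul_nonneg (P.v_pos i).le (hx i).1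

variable (P) in
theorem p_nonneg {C : ℝ} (hC : 0 ≤ C) (a₅ : ℝ) (t : ℕ) : 0 ≤ P.p C a₅ t := by
  have k_pos := P.k_pos
  rw [p]
  split_ifs <;> positivity

theorem expect_eq (f : P.Arrival → ℝ) : P.expect f = 𝔼 I, f I :=
  (Fintype.expect_eq_sum_div_card f).symm

theorem one_sub_condProb_sub_condProb_le {t : P.RO} (i : Fin #P.RO) {τ φ : P.Arrival → ℝ}
    (hτ : ∀ I, τ I = 0 ∨ τ I = 1) (hφ : ∀ I, φ I = 0 ∨ φ I = 1) :
    1 - P.condProb (fun I => τ I = 0) t i - P.condProb (fun I => φ I = 0) t i ≤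
      𝔼 I : P.Arrival with I t = i, τ I * φ I := by
  classical
  rw [condProb_eq_expect, condProb_eq_expect]
  nth_rw 1 [← expect_const (filter_arrival_nonempty t i) (1 : ℝ)]
  rw [← expect_sub_distrib, ← expect_sub_distrib]
  refine expect_le_expect fun I _ => ?_
  rcases hτ I with h | h <;> rcases hφ I with h' | h' <;> simp [h, h']

theorem le_expect_of_condProb_le (t : P.RO) {U : Finset (Fin #P.RO)} {b b' : ℝ}
    {τ φ : P.Arrival → ℝ} (hτ : ∀ I, τ I = 0 ∨ τ I = 1) (hφ : ∀ I, φ I = 0 ∨ φ I = 1)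
    (hb : ∀ i ∈ U, P.condProb (fun I => τ I = 0) t i ≤ b)
    (hb' : ∀ i ∈ U, P.condProb (fun I => φ I = 0) t i ≤ b') :
    (1 - b - b') * (∑ i ∈ U, P.v i) / #P.RO ≤ P.expect fun I => P.v (I t) * τ I * φ I := by
  have product_nonneg (I : P.Arrival) : 0 ≤ τ I * φ I := by
    rcases hτ I with h | h <;> rcases hφ I with h' | h' <;> simp [h, h']
  have given_item (i : Fin #P.RO) : 𝔼 I : P.Arrival with I t = i, P.v (I t) * τ I * φ I =
      P.v i * 𝔼 I : P.Arrival with I t = i, τ I * φ I := by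
    rw [mul_expect]
    refine expect_congr rfl fun I hI => ?_
    rw [(mem_filter.1 hI).2, mul_assoc]
  rw [expect_eq, ← expect_expect_bijection_fiber t, Fintype.expect_eq_sum_div_card,
    Fintype.card_fin]
  gcongr
  calc (1 - b - b') * ∑ i ∈ U, P.v i
      = ∑ i ∈ U, P.v i * (1 - b - b') := by rw [mul_comm, sum_mul]
    _ ≤ ∑ i ∈ U, 𝔼 I : P.Arrival with I t = i, P.v (I t) * τ I * φ I := by
        refine sum_le_sum fun i hi => ?_
        rw [given_item]
        refine mul_le_mul_of_nonneg_left ?_ (P.v_pos i).le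
        linarith [hb i hi, hb' i hi, one_sub_condProb_sub_condProb_le (t := t) i hτ hφ]
    _ ≤ ∑ i, 𝔼 I : P.Arrival with I t = i, P.v (I t) * τ I * φ I :=
        sum_le_univ_sum_of_nonneg fun i => (given_item i).symm ▸
          mul_nonneg (P.v_pos i).le (expect_nonneg fun I _ => product_nonneg I)

variable {a₄ : ℝ} {A : P.Adversary} {X : P.Arrival → ℕ → ℕ → ℝ} {t : P.RO}

theorem expect_collected_nonneg (A : P.Adversary) (X : P.Arrival → ℕ → ℕ → ℝ) (t : P.RO) :
    0 ≤ P.expect fun I => A.V I t * T (X I) t * P.F a₄ (A.W I) (X I) t := by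
  rw [expect_eq]
  refine expect_nonneg fun I _ => ?_
  have V_nonneg := A.V_nonneg I t (P.RO_subset t.2)
  rcases T_eq_zero_or_one (X I) t with h | h <;>
    rcases P.F_eq_zero_or_one a₄ (A.W I) (X I) t with h' | h' <;> simp [h, h', V_nonneg]

theorem four_mul_Γ_le_window (ht : 4 * P.Γ * P.ℓ < t) : 4 * P.Γ ≤ P.window t := by
  rwa [← not_lt, P.window_lt_iff (one_le_of_RO t), not_le]

theorem le_expect_collected (hX : P.IsLPChoice A X) (ha₄ : 602 ≤ a₄) (ht : t ∈ P.free) :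
    (P.c t - P.ε t - P.p 6 (6 * a₄ + 4) t - 2 / P.k) * (P.OPT / #P.RO) ≤
      P.expect fun I => A.V I t * T (X I) t * P.F a₄ (A.W I) (X I) t := by
  have k_pos := P.k_pos
  have p_nonneg := P.p_nonneg (C := 6) (by norm_num) (6 * a₄ + 4) t
  have two_div_k_pos : 0 < 2 / P.k := by positivity
  set γ := P.c t - P.ε t with γ_eq
  set q := P.p 6 (6 * a₄ + 4) t
  rcases le_or_gt (γ - q - 2 / P.k) 0 with nonpos | pos
  · exact (mul_nonpos_of_nonpos_of_nonneg nonpos (div_nonneg P.OPT_nonneg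
      (Nat.cast_nonneg _))).trans (expect_collected_nonneg A X t)
  have γ_pos : 0 < γ := by linarith
  have γ_le_one : γ ≤ 1 := by linarith [P.c_le_one t, P.ε_nonneg t]
  have hΓ := four_mul_Γ_le_window (lt_of_c_pos (one_le_of_RO t) (by linarith [P.ε_nonneg t]))
  have collected := le_expect_of_condProb_le t (fun I => T_eq_zero_or_one (X I) t)
    (fun I => P.F_eq_zero_or_one a₄ (A.W I) (X I) t)
    (fun i hi => condProb_not_selected_le hX ht γ_pos hi)
    (fun i _ => condProb_blocked_le hX ha₄ ht hΓ i)
  simp only [← A.V_RO] at collected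
  refine le_trans ?_ collected
  rw [← mul_div_assoc]
  gcongr ?_ / _
  calc (γ - q - 2 / P.k) * P.OPT ≤ (1 - 2 / P.k - q) * (γ * P.OPT) := by
        rw [← mul_assoc]
        refine mul_le_mul_of_nonneg_right ?_ P.OPT_nonneg
        nlinarith
    _ ≤ _ := mul_le_mul_of_nonneg_left (mul_OPT_le γ_pos γ_le_one) (by linarith)

end CollectedValue

end BARO

theorem mainTheorem4_general {a₄ : ℝ} (ha₄ : 602 ≤ a₄) (P : BARO) (A : P.Adversary)
    (X : P.Arrival → ℕ → ℕ → ℝ) (hX : P.IsLPChoice A X) (t : ℕ) (ht : P.IsFree t) :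
    (4 * P.Γ * P.ℓ < t → ∀ i : Fin P.RO.card,
      P.condProb (fun I => P.F a₄ (A.W I) (X I) t = 0) ⟨t, ht.mem_RO⟩ i ≤
        P.p 6 (6 * a₄ + 4) t) ∧
    (P.c t - P.ε t - P.p 6 (6 * a₄ + 4) t - 2 / P.k) * (P.OPT / P.RO.card) ≤
      P.expect fun I => A.V I t * BARO.T (X I) t * P.F a₄ (A.W I) (X I) t := by
  have free : ⟨t, ht.mem_RO⟩ ∈ P.free := BARO.mem_free.2 ht.2
  refine ⟨fun hΓ i => ?_, BARO.le_expect_collected (t := ⟨t, ht.mem_RO⟩) hX ha₄ free⟩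
  exact BARO.condProb_blocked_le (t := ⟨t, ht.mem_RO⟩) hX ha₄ free
    (BARO.four_mul_Γ_le_window (t := ⟨t, ht.mem_RO⟩) hΓ) i

theorem mainTheorem4 :
    ∃ A₄ : ℝ, ∀ a₄ : ℝ, A₄ ≤ a₄ → ∃ C > (0 : ℝ), ∃ a₅ > (0 : ℝ),
      ∀ (P : BARO) (A : P.Adversary) (X : P.Arrival → ℕ → ℕ → ℝ), P.IsLPChoice A X →
        ∀ (t : ℕ) (ht : P.IsFree t),
          (8 * (P.ℓ : ℝ) * (P.Γ + 2) ≤ t → ∀ i : Fin P.RO.card,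
            P.condProb (fun I => P.F a₄ (A.W I) (X I) t = 0) ⟨t, ht.mem_RO⟩ i ≤ P.p C a₅ t) ∧
          (1212 * (P.Γ : ℝ) * P.ℓ ≤ t →
            (P.c t - P.ε t - P.p C a₅ t - 2 / P.k) * (P.OPT / P.RO.card) ≤
              P.expect fun I => A.V I t * BARO.T (X I) t * P.F a₄ (A.W I) (X I) t) := by
  refine ⟨602, fun a₄ ha₄ => ⟨6, by norm_num, 6 * a₄ + 4, by linarith, fun P A X hX t ht => ?_⟩⟩
  obtain ⟨blocked, collected⟩ := mainTheorem4_general ha₄ P A X hX t ht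
  refine ⟨fun h8 => blocked ?_, fun _ => collected⟩
  have h8' : 8 * P.ℓ * (P.Γ + 2) ≤ t := by exact_mod_cast h8
  nlinarith [P.ℓ_pos, Nat.zero_le (P.Γ * P.ℓ)]
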